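/- For $A\in \mathfrak{sl}(n,\mathbb C)$ write $A^*=\overline A^{T}$, $|A|^2=\mathrm{tr}(AA^*)$, and let $\mathcal O_A=\{gAg^{-1}: g\in SL(n,\mathbb C)\}$. Put $Z=\{A\in \mathfrak{sl}(n,\mathbb C): |A|^4-|\mathrm{tr}(A^2)|^2=0\}$, $W=\{A\in \mathfrak{sl}(n,\mathbb C): [A,A^*]=0\}$, and for $A\in \mathfrak{sl}(n,\mathbb C)\setminus Z$ $$K(A)=\frac{|[A,A^*]|^2}{|A|^4-|\mathrm{tr}(A^2)|^2}.$$ For $m\ge 1$ let $j_m:\mathfrak{sl}(2,\mathbb C)\to \mathfrak{sl}(m,\mathbb C)$ be the irreducible representation sending $\begin{pmatrix}0&1\\0&0\end{pmatrix}$, $\begin{pmatrix}0&0\\1&0\end{pmatrix}$, $\begin{pmatrix}1&0\\0&-1\end{pmatrix}$ respectively to the matrix $e_m$ with entries $\sqrt{k(m-k)}$, $k=1,\dots,m-1$, on the superdiagonal and zeros elsewhere, to its transpose, and to $\mathrm{diag}(m-1,m-3,\dots,1-m)$. For a partition $\pi=(n_1\ge\dots\ge n_s>0)$ of $n$ let $j_\pi=\mathrm{diag}(j_{n_1},\dots,j_{n_s})$;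 its image is called the standard $\mathfrak{sl}(2,\mathbb C)$ of type $\pi$. It is called even if $n_1,\dots,n_s$ all have the same parity. Put $E^\pi=\mathrm{diag}(e_{n_1},\dots,e_{n_s})$ and, if $\pi\ne(1,\dots,1)$, $$C_\pi=\frac{|[E^\pi,(E^\pi)^*]|^2}{|E^\pi|^4}=\frac{12}{\sum_{p=1}^s n_p(n_p^2-1)}.$$ **Theorem.** Let $A\in \mathfrak{sl}(n,\mathbb C)$ be not a scalar matrix, and suppose that $A$ is not $SL(n,\mathbb C)$-conjugate to an element of $W\setminus Z$. Then: (1) $A$ is a critical point of the function $K$ on $\mathcal O_A\setminus Z$ if and only if $A,A^*,[A,A^*]$ generate a three-dimensional complex Lie subalgebra $\mathfrak s$ which is $SU(n)$-conjugate to a standard $\mathfrak{sl}(2,\mathbb C)$. (Being a critical point on $\mathcal O_A\setminus Z$ includes $A\notin Z$.) (2) On the standard $\mathfrak{sl}(2,\mathbb C)$ of type $\pi$, for every partition $\pi$ of $n$, the function $K$ is equal to $C_\pi$ outside $Z$. (3) If $A$ is nilpotent, then $K$ on $\mathcal O_A\setminus Z$ achieves its minimum value at $A$ if and only if $A$ is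 $SU(n)$-conjugate to an element of a standard $\mathfrak{sl}(2,\mathbb C)$. (4) If $A$ is not nilpotent, then $K$ on $\mathcal O_A\setminus Z$ achieves its minimum value at $A$ (so that in particular $A\notin Z$) if and only if $A\notin Z$ and $A$ is $SU(n)$-conjugate to an element of an even standard $\mathfrak{sl}(2,\mathbb C)$. -/

import Mathlib

open Matrix

attribute [local instance] LieRing.ofAssociativeRing

namespace NessSl2

/-- The squared norm `|A|² = tr(A A*)`. -/
noncomputable def normSq {n : ℕ} (A : Matrix (Fin n) (Fin n) ℂ) : ℝ :=
  (A * Aᴴ).trace.re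

/-- The degeneracy set `Z = {A ∈ sl(n, ℂ) : |A|⁴ - |tr(A²)|² = 0}`. -/
def Z (n : ℕ) : Set (Matrix (Fin n) (Fin n) ℂ) :=
  {A | A.trace = 0 ∧ normSq A ^ 2 - ‖(A ^ 2).trace‖ ^ 2 = 0}

/-- The set `W = {A ∈ sl(n, ℂ) : [A, A*] = 0}`. -/
def W (n : ℕ) : Set (Matrix (Fin n) (Fin n) ℂ) :=
  {A | A.trace = 0 ∧ ⁅A, Aᴴ⁆ = 0}

/-- The function `K(A) = |[A, A*]|² / (|A|⁴ - |tr(A²)|²)`; it is only used on `sl(n, ℂ)` off `Z`. -/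
noncomputable def K {n : ℕ} (A : Matrix (Fin n) (Fin n) ℂ) : ℝ :=
  normSq ⁅A, Aᴴ⁆ / (normSq A ^ 2 - ‖(A ^ 2).trace‖ ^ 2)

/-- The function `K₀(A) = |[A, A*]|² / |A|⁴`. -/
noncomputable def K₀ {n : ℕ} (A : Matrix (Fin n) (Fin n) ℂ) : ℝ :=
  normSq ⁅A, Aᴴ⁆ / normSq A ^ 2

/-- The action `Ad(g) A = g A g⁻¹` of `SL(n, ℂ)`. -/
def Ad {n : ℕ} (g : SpecialLinearGroup (Fin n) ℂ) (A : Matrix (Fin n) (Fin n) ℂ) :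
    Matrix (Fin n) (Fin n) ℂ :=
  (g : Matrix (Fin n) (Fin n) ℂ) * A * ((g⁻¹ : SpecialLinearGroup (Fin n) ℂ) :
    Matrix (Fin n) (Fin n) ℂ)

/-- The adjoint orbit `𝒪_A`. -/
def orbit {n : ℕ} (A : Matrix (Fin n) (Fin n) ℂ) : Set (Matrix (Fin n) (Fin n) ℂ) :=
  {B | ∃ g : SpecialLinearGroup (Fin n) ℂ, B = Ad g A}

/-- `A` is a critical point of `K` on `𝒪_A \ Z`: it lies in this set, and the derivative of `K` at
`A` vanishes along every curve `t ↦ Ad(g(t)) A` of the orbit, where `g` is a curve in `SL(n, ℂ)`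
with `g(0) = 1` that is differentiable at `0`.  The velocities of these curves fill up the tangent
space `{[M, A] : M ∈ sl(n, ℂ)}` of the homogeneous space `𝒪_A` at `A`. -/
def IsCriticalPoint {n : ℕ} (A : Matrix (Fin n) (Fin n) ℂ) : Prop :=
  A ∈ orbit A \ Z n ∧
    ∀ g : ℝ → SpecialLinearGroup (Fin n) ℂ, g 0 = 1 →
      (∀ i j, DifferentiableAt ℝ (fun t => (g t : Matrix (Fin n) (Fin n) ℂ) i j) 0) →
      HasDerivAt (fun t => K (Ad (g t) A)) 0 0

/-- `K` restricted to `𝒪_A \ Z` achieves its minimum value at `A`. -/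
def AttainsMin {n : ℕ} (A : Matrix (Fin n) (Fin n) ℂ) : Prop :=
  A ∈ orbit A \ Z n ∧ IsMinOn K (orbit A \ Z n) A

/-- The irreducible representation `j_m` of `sl(2, ℂ)` on binary forms of degree `m - 1`, in the
basis `√(m-1 choose k) X^(m-1-k) Y^k`, `k = 0, …, m - 1`.  It maps `e, ẽ, x` to the matrices
`e_m` (entries `√(k (m - k))`, `1 ≤ k ≤ m - 1`, above the diagonal), `ẽ_m = e_mᵀ` and
`x_m = diag(m - 1, m - 3, …, 1 - m)`.  The argument `M = M₀₁ e + M₁₀ ẽ + M₀₀ x` is trace-free. -/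
noncomputable def irrep (m : ℕ) (M : Matrix (Fin 2) (Fin 2) ℂ) : Matrix (Fin m) (Fin m) ℂ :=
  Matrix.of fun i j =>
    if (j : ℕ) = i + 1 then M 0 1 * (Real.sqrt ((j : ℝ) * ((m : ℝ) - j)) : ℂ)
    else if (i : ℕ) = j + 1 then M 1 0 * (Real.sqrt ((i : ℝ) * ((m : ℝ) - i)) : ℂ)
    else if i = j then M 0 0 * ((m : ℂ) - 1 - 2 * (i : ℂ))
    else 0

/-- The parts `n₁ ≥ n₂ ≥ ⋯ ≥ n_s > 0` of a partition of `n`. -/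
def sortedParts {n : ℕ} (π : n.Partition) : List ℕ :=
  π.parts.sort (· ≥ ·)

theorem sum_sortedParts {n : ℕ} (π : n.Partition) :
    ∑ p : Fin (sortedParts π).length, (sortedParts π).get p = n := by
  have h : (sortedParts π).sum = n := by
    rw [← Multiset.sum_coe, sortedParts, Multiset.sort_eq, π.parts_sum]
  exact (Fin.sum_univ_getElem (sortedParts π)).trans h

/-- The positions `1, …, n`, cut into consecutive blocks of sizes `n₁, …, n_s`. -/
def blockEquiv {n : ℕ} (π : n.Partition) :
    (Σ p : Fin (sortedParts π).length, Fin ((sortedParts π).get p)) ≃ Fin n :=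
  finSigmaFinEquiv.trans (finCongr (sum_sortedParts π))

/-- The representation `j_π = diag(j_{n₁}, …, j_{n_s})` of `sl(2, ℂ)`. -/
noncomputable def stdRep {n : ℕ} (π : n.Partition) (M : Matrix (Fin 2) (Fin 2) ℂ) :
    Matrix (Fin n) (Fin n) ℂ :=
  Matrix.reindex (blockEquiv π) (blockEquiv π)
    (Matrix.blockDiagonal' fun p => irrep ((sortedParts π).get p) M)

/-- The standard `sl(2, ℂ)` of type `π`: the image `j_π(sl(2, ℂ))`. -/
def stdSl2 {n : ℕ} (π : n.Partition) : Set (Matrix (Fin n) (Fin n) ℂ) :=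
  {B | ∃ M : Matrix (Fin 2) (Fin 2) ℂ, M.trace = 0 ∧ B = stdRep π M}

/-- The nilpotent element `E^π = j_π(e) = diag(e_{n₁}, …, e_{n_s})`. -/
noncomputable def stdE {n : ℕ} (π : n.Partition) : Matrix (Fin n) (Fin n) ℂ :=
  stdRep π !![0, 1; 0, 0]

/-- The constant `C_π = K₀(E^π)`. -/
noncomputable def typeConst {n : ℕ} (π : n.Partition) : ℝ :=
  K₀ (stdE π)

/-- A partition is even if all its (positive) parts have the same parity. -/
def IsEvenType {n : ℕ} (π : n.Partition) : Prop :=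
  ∀ a ∈ π.parts, ∀ b ∈ π.parts, (Even a ↔ Even b)

/-- `A` is `SU(n)`-conjugate to an element of the set `S`. -/
def SUConjInto {n : ℕ} (A : Matrix (Fin n) (Fin n) ℂ) (S : Set (Matrix (Fin n) (Fin n) ℂ)) :
    Prop :=
  ∃ U ∈ specialUnitaryGroup (Fin n) ℂ, ∃ B ∈ S, A = U * B * Uᴴ

/-- The complex Lie subalgebra generated by `A, A*, [A, A*]`. -/
def genAlg {n : ℕ} (A : Matrix (Fin n) (Fin n) ℂ) :
    LieSubalgebra ℂ (Matrix (Fin n) (Fin n) ℂ) :=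
  LieSubalgebra.lieSpan ℂ (Matrix (Fin n) (Fin n) ℂ) {A, Aᴴ, ⁅A, Aᴴ⁆}

/-- The Lie subalgebra `𝔰` is `SU(n)`-conjugate to a standard `sl(2, ℂ)`. -/
def IsSUConjToStd {n : ℕ} (𝔰 : LieSubalgebra ℂ (Matrix (Fin n) (Fin n) ℂ)) : Prop :=
  ∃ U ∈ specialUnitaryGroup (Fin n) ℂ, ∃ π : n.Partition,
    (𝔰 : Set (Matrix (Fin n) (Fin n) ℂ)) = (fun B => U * B * Uᴴ) '' stdSl2 π

end NessSl2

namespace NessSl2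

variable {n : ℕ}

/-! ### The Frobenius norm -/

/-! Write μ = [A, A*], D(A) = |A|⁴ - |tr(A²)|² (`discr`). Along a curve of the orbit with velocity
[M, A], the derivative of K is a positive multiple of Re tr(M · `critGrad A`) (`hasDerivAt_K_Ad`).
Since `critGrad A` is hermitian and trace-free, it may itself serve as M, so off Z criticality means
D(A) [A, [A*, μ]] = |μ|² |A|² μ.

Pairing this equation with μ gives equality in Cauchy-Schwarz for [μ, A] and the component of A
orthogonal to A* (`lie_lie_eq_of_critGrad_eq_zero`). Hence ad μ preserves the span of A and A*. If μ
≠ 0, diagonalizing it there produces a hermitian H and an eigenvector E with [H, E] = 2E, [E, E*] =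
H: a unitary triple spanning the generated algebra (`exists_isUnitaryTriple_of_critGrad_eq_zero`).
The hypothesis on W excludes μ = 0. A unitary representation of sl(2) has an orthonormal basis of
weight strings, which makes the triple conjugate to a standard one (`exists_string_basis`,
`IsUnitaryTriple.exists_conj_std`). Conversely, every B in the span of a triple satisfies |H|² |[B,
B*]|² = 4 D(B) (`normSq_lie_comb`); so K = 4 / |H|² there off Z, and all these points are critical.

A minimum is a critical point, so for (3) and (4) it remains to compare 4 / |H|² with K on the whole
orbit. By Gram-Schmidt a conjugating matrix is unitary times triangular for the weight flag, and K
is unitarily invariant. A nilpotent element of the algebra is conjugate to a multiple of E or E*; a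
triangular conjugate keeps degree at least 2, and Cauchy-Schwarz against H gives K ≥ 4 / |H|²
(`HasDeg.normSq_lie_ge`). A non-nilpotent one is conjugate to a multiple of H; for an even type the
distinct weights differ by at least 2, a triangular conjugate is H + N with N of degree at least 2,
and Bessel's inequality gives the same bound (`HasDeg.normSq_lie_diagonal_add_ge`). If the type is
not even, weights 0 and 1 both occur, and adding a matrix unit between them gives a conjugate of H
with a smaller K (`K_diagonal_add_single`). -/

theorem ofReal_normSq (A : Matrix (Fin n) (Fin n) ℂ) : (normSq A : ℂ) = (A * Aᴴ).trace := by
  refine Complex.ext rfl ?_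
  have h : star (A * Aᴴ).trace = (A * Aᴴ).trace := by
    rw [← trace_conjTranspose, conjTranspose_mul, conjTranspose_conjTranspose]
  simpa using (Complex.conj_eq_iff_im.mp h).symm

theorem normSq_eq_sum (A : Matrix (Fin n) (Fin n) ℂ) : normSq A = ∑ i, ∑ j, ‖A i j‖ ^ 2 := by
  simp only [normSq, trace, diag_apply, mul_apply, conjTranspose_apply, Complex.re_sum]
  refine Finset.sum_congr rfl fun i _ => Finset.sum_congr rfl fun j _ => ?_
  rw [RCLike.star_def, Complex.mul_conj, Complex.normSq_eq_norm_sq, Complex.ofReal_re]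

theorem normSq_nonneg (A : Matrix (Fin n) (Fin n) ℂ) : 0 ≤ normSq A := by
  rw [normSq_eq_sum]; positivity

open scoped ComplexOrder in
theorem normSq_eq_zero {A : Matrix (Fin n) (Fin n) ℂ} : normSq A = 0 ↔ A = 0 := by
  rw [← trace_mul_conjTranspose_self_eq_zero_iff, ← ofReal_normSq, Complex.ofReal_eq_zero]

theorem normSq_pos {A : Matrix (Fin n) (Fin n) ℂ} : 0 < normSq A ↔ A ≠ 0 := by
  rw [(normSq_nonneg A).lt_iff_ne, ne_comm, Ne, normSq_eq_zero]

theorem normSq_smul (c : ℂ) (A : Matrix (Fin n) (Fin n) ℂ) :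
    normSq (c • A) = ‖c‖ ^ 2 * normSq A := by
  simp only [normSq_eq_sum, Finset.mul_sum, Matrix.smul_apply, smul_eq_mul, norm_mul, mul_pow]

theorem conjTranspose_lie (A B : Matrix (Fin n) (Fin n) ℂ) : ⁅A, B⁆ᴴ = ⁅Bᴴ, Aᴴ⁆ := by
  simp [Ring.lie_def]

theorem isHermitian_lie_conjTranspose (A : Matrix (Fin n) (Fin n) ℂ) : ⁅A, Aᴴ⁆ᴴ = ⁅A, Aᴴ⁆ := by
  simp [conjTranspose_lie]

theorem trace_lie (A B : Matrix (Fin n) (Fin n) ℂ) : ⁅A, B⁆.trace = 0 := by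
  rw [Ring.lie_def, trace_sub, trace_mul_comm, sub_self]

/-- Invariance of the trace form, the source of nearly all orthogonality relations below. -/
theorem trace_lie_mul (A B C : Matrix (Fin n) (Fin n) ℂ) :
    (⁅A, B⁆ * C).trace = (A * ⁅B, C⁆).trace := by
  rw [Ring.lie_def, Ring.lie_def, Matrix.sub_mul, Matrix.mul_sub, trace_sub, trace_sub,
    ← Matrix.mul_assoc, ← Matrix.mul_assoc, trace_mul_comm (A * C) B, Matrix.mul_assoc B A C]

/-- The denominator of `K`. -/
noncomputable def discr (A : Matrix (Fin n) (Fin n) ℂ) : ℝ :=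
  normSq A ^ 2 - ‖(A ^ 2).trace‖ ^ 2

theorem K_eq (A : Matrix (Fin n) (Fin n) ℂ) : K A = normSq ⁅A, Aᴴ⁆ / discr A := rfl

theorem discr_smul (c : ℂ) (A : Matrix (Fin n) (Fin n) ℂ) :
    discr (c • A) = ‖c‖ ^ 4 * discr A := by
  rw [discr, discr, normSq_smul, smul_pow, trace_smul, smul_eq_mul, norm_mul, norm_pow]; ring

theorem lie_smul_conjTranspose (c : ℂ) (A : Matrix (Fin n) (Fin n) ℂ) :
    ⁅c • A, (c • A)ᴴ⁆ = (c * star c) • ⁅A, Aᴴ⁆ := by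
  rw [conjTranspose_smul, smul_lie, lie_smul, smul_smul]

theorem K_smul {c : ℂ} (hc : c ≠ 0) (A : Matrix (Fin n) (Fin n) ℂ) : K (c • A) = K A := by
  have h : ‖c‖ ≠ 0 := norm_ne_zero_iff.mpr hc
  rw [K_eq, K_eq, discr_smul, lie_smul_conjTranspose, normSq_smul, norm_mul, norm_star,
    show (‖c‖ * ‖c‖) ^ 2 = ‖c‖ ^ 4 by ring, mul_div_mul_left _ _ (pow_ne_zero 4 h)]

theorem normSq_add (A B : Matrix (Fin n) (Fin n) ℂ) :
    normSq (A + B) = normSq A + normSq B + 2 * (A * Bᴴ).trace.re := by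
  have h : (B * Aᴴ).trace.re = (A * Bᴴ).trace.re := by
    have : (B * Aᴴ).trace = star (A * Bᴴ).trace := by
      rw [← trace_conjTranspose, conjTranspose_mul, conjTranspose_conjTranspose]
    rw [this]; simp
  simp only [normSq, conjTranspose_add, Matrix.add_mul, Matrix.mul_add, trace_add, Complex.add_re, h]
  ring

/-- `|A|² |A - s A*|² = |A|⁴ - |tr(A²)|²` for `s = tr(A²) / |A|²`. -/
theorem normSq_sub_proj (A : Matrix (Fin n) (Fin n) ℂ) (hA : A ≠ 0) :
    normSq A * normSq (A - ((A ^ 2).trace / normSq A) • Aᴴ) = discr A := by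
  have h0 : (normSq A : ℂ) ≠ 0 := by exact_mod_cast (normSq_pos.mpr hA).ne'
  have h1 : (Aᴴ * Aᴴ).trace = star (A * A).trace := by
    rw [← trace_conjTranspose, conjTranspose_mul]
  apply Complex.ofReal_injective
  rw [Complex.ofReal_mul, ofReal_normSq (A - _), discr]
  simp only [conjTranspose_sub, conjTranspose_smul, conjTranspose_conjTranspose, Matrix.sub_mul,
    Matrix.mul_sub, trace_sub, Matrix.smul_mul, Matrix.mul_smul, trace_smul, smul_eq_mul,
    trace_mul_comm Aᴴ A, ← ofReal_normSq, pow_two, h1, star_div₀, RCLike.star_def, Complex.conj_ofReal]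
  have h2 : ((‖(A * A).trace‖ * ‖(A * A).trace‖ : ℝ) : ℂ) =
      (A * A).trace * (starRingEnd ℂ) (A * A).trace := by
    rw [Complex.mul_conj, Complex.normSq_eq_norm_sq, sq]
  rw [Complex.ofReal_sub, h2]
  push_cast
  field_simp
  ring

theorem discr_nonneg (A : Matrix (Fin n) (Fin n) ℂ) : 0 ≤ discr A := by
  by_cases hA : A = 0
  · simp [discr, hA, normSq]
  · rw [← normSq_sub_proj A hA]
    exact mul_nonneg (normSq_nonneg _) (normSq_nonneg _)

theorem notMem_Z_iff {A : Matrix (Fin n) (Fin n) ℂ} (hA : A.trace = 0) : A ∉ Z n ↔ 0 < discr A := by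
  rw [(discr_nonneg A).lt_iff_ne, ne_comm]
  simp [Z, discr, hA]

/-! ### Unitary `sl(2)`-triples -/

/-- `H`, `E`, `E*` satisfy the relations of the standard basis of `sl(2, ℂ)`, and `H` is
hermitian. -/
structure IsUnitaryTriple (H E : Matrix (Fin n) (Fin n) ℂ) : Prop where
  isHermitian : Hᴴ = H
  lie_h_e : ⁅H, E⁆ = (2 : ℂ) • E
  lie_e_f : ⁅E, Eᴴ⁆ = H

/-- The element of the span of a triple with given coordinates. -/
def comb (H E : Matrix (Fin n) (Fin n) ℂ) (a b c : ℂ) : Matrix (Fin n) (Fin n) ℂ :=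
  a • H + b • E + c • Eᴴ

namespace IsUnitaryTriple

variable {H E : Matrix (Fin n) (Fin n) ℂ} (t : IsUnitaryTriple H E)
include t

theorem lie_h_f : ⁅H, Eᴴ⁆ = (-2 : ℂ) • Eᴴ := by
  have h := congrArg conjTranspose t.lie_h_e
  rw [conjTranspose_lie, t.isHermitian, conjTranspose_smul, ← lie_skew] at h
  rw [neg_smul, ← neg_eq_iff_eq_neg, h]; simp

theorem lie_comb (a b c x y z : ℂ) :
    ⁅comb H E a b c, comb H E x y z⁆ =
      comb H E (b * z - c * y) (2 * (a * y - b * x)) (2 * (c * x - a * z)) := by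
  have h1 : ⁅E, H⁆ = (-2 : ℂ) • E := by rw [← lie_skew, t.lie_h_e, neg_smul]
  have h2 : ⁅Eᴴ, H⁆ = (2 : ℂ) • Eᴴ := by rw [← lie_skew, t.lie_h_f, neg_smul, neg_neg]
  have h3 : ⁅Eᴴ, E⁆ = -H := by rw [← lie_skew, t.lie_e_f]
  simp only [comb, lie_add, add_lie, lie_smul, smul_lie, lie_self, t.lie_h_e, t.lie_h_f, t.lie_e_f,
    h1, h2, h3]
  module

theorem conjTranspose_comb (a b c : ℂ) :
    (comb H E a b c)ᴴ = comb H E (star a) (star c) (star b) := by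
  simp only [comb, conjTranspose_add, conjTranspose_smul, t.isHermitian, conjTranspose_conjTranspose]
  abel

theorem trace_comb_mul_comb (a b c x y z : ℂ) :
    (comb H E a b c * comb H E x y z).trace = normSq H * (a * x + (b * z + c * y) / 2) := by
  have hHH : (H * H).trace = normSq H := by
    conv_rhs => rw [ofReal_normSq, t.isHermitian]
  have hEF : (E * Eᴴ).trace = normSq H / 2 := by
    have h := trace_lie_mul E Eᴴ H
    rw [t.lie_e_f, ← lie_skew, t.lie_h_f, hHH] at h
    simp only [neg_smul, neg_neg, Matrix.mul_smul, trace_smul, smul_eq_mul] at h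
    rw [h]; ring
  have hFE : (Eᴴ * E).trace = normSq H / 2 := by rw [trace_mul_comm, hEF]
  have hHE : (H * E).trace = 0 := by
    have h := trace_lie_mul H H E
    rw [t.lie_h_e, lie_self] at h
    simpa [Matrix.mul_smul, trace_smul] using h
  have hHF : (H * Eᴴ).trace = 0 := by
    have h := trace_lie_mul H H Eᴴ
    rw [t.lie_h_f, lie_self] at h
    simpa [Matrix.mul_smul, trace_smul] using h
  have hEE : (E * E).trace = 0 := by
    have h := trace_lie_mul H E E
    rw [t.lie_h_e, lie_self] at h
    simpa [trace_smul] using h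
  have hFF : (Eᴴ * Eᴴ).trace = 0 := by rw [← conjTranspose_mul, trace_conjTranspose, hEE, star_zero]
  have hEH : (E * H).trace = 0 := by rw [trace_mul_comm, hHE]
  have hFH : (Eᴴ * H).trace = 0 := by rw [trace_mul_comm, hHF]
  simp only [comb, Matrix.add_mul, Matrix.mul_add, Matrix.smul_mul, Matrix.mul_smul, trace_add,
    trace_smul, smul_eq_mul, hHH, hEF, hFE, hHE, hHF, hEE, hFF, hEH, hFH]
  ring

theorem normSq_comb (a b c : ℂ) :
    normSq (comb H E a b c) = normSq H * (‖a‖ ^ 2 + (‖b‖ ^ 2 + ‖c‖ ^ 2) / 2) := by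
  apply Complex.ofReal_injective
  rw [ofReal_normSq, t.conjTranspose_comb, t.trace_comb_mul_comb]
  simp only [RCLike.star_def, Complex.mul_conj, Complex.normSq_eq_norm_sq]
  push_cast
  ring

theorem trace_sq_comb (a b c : ℂ) :
    ((comb H E a b c) ^ 2).trace = normSq H * (a ^ 2 + b * c) := by
  rw [sq, t.trace_comb_mul_comb]; ring

theorem lie_comb_conjTranspose (a b c : ℂ) :
    ⁅comb H E a b c, (comb H E a b c)ᴴ⁆ = comb H E (b * star b - c * star c)
      (2 * (a * star c - b * star a)) (2 * (c * star a - a * star b)) := by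
  rw [t.conjTranspose_comb, t.lie_comb]

/-- The numerator and the denominator of K are proportional on the span of a triple; this is why K
is constant there. -/
theorem normSq_lie_comb (a b c : ℂ) :
    normSq H * normSq ⁅comb H E a b c, (comb H E a b c)ᴴ⁆ = 4 * discr (comb H E a b c) := by
  rw [t.lie_comb_conjTranspose, discr, t.normSq_comb, t.normSq_comb, t.trace_sq_comb]
  simp only [norm_mul, mul_pow, ← Complex.normSq_eq_norm_sq, Complex.normSq_apply]
  simp [-map_mul, -map_add, pow_two]
  ring

/-- Together with `normSq_lie_comb` this makes `critGrad` vanish on the span. -/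
theorem lie_lie_comb (a b c : ℂ) (A : Matrix (Fin n) (Fin n) ℂ) (hA : A = comb H E a b c) :
    (normSq H : ℂ) • ⁅A, ⁅Aᴴ, ⁅A, Aᴴ⁆⁆⁆ = (4 * normSq A : ℂ) • ⁅A, Aᴴ⁆ := by
  rw [hA, t.lie_comb_conjTranspose, t.conjTranspose_comb, t.lie_comb, t.lie_comb, t.normSq_comb]
  have h (z : ℂ) : ((‖z‖ : ℝ) : ℂ) ^ 2 = z * star z := by
    rw [RCLike.star_def, Complex.mul_conj, Complex.normSq_eq_norm_sq, Complex.ofReal_pow]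
  push_cast
  simp only [comb, smul_add, smul_smul, h]
  congr 2
  · congr 1; ring
  · congr 1; ring
  · ring

theorem K_comb {a b c : ℂ} (h : 0 < discr (comb H E a b c)) :
    K (comb H E a b c) = 4 / normSq H := by
  have hH : normSq H ≠ 0 := fun h0 => by
    have := t.normSq_lie_comb a b c
    rw [h0, zero_mul] at this
    linarith
  rw [K_eq, div_eq_div_iff h.ne' hH, mul_comm, t.normSq_lie_comb]

theorem comb_eq_zero_iff (hE : E ≠ 0) {a b c : ℂ} :
    comb H E a b c = 0 ↔ a = 0 ∧ b = 0 ∧ c = 0 := by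
  have hH : normSq H ≠ 0 := fun h0 => hE <| by
    rw [normSq_eq_zero] at h0
    have := t.lie_h_e
    rw [h0, zero_lie] at this
    simpa using this.symm
  rw [← normSq_eq_zero, t.normSq_comb, mul_eq_zero, or_iff_right hH]
  constructor
  · intro h
    have := sq_nonneg ‖a‖; have := sq_nonneg ‖b‖; have := sq_nonneg ‖c‖
    refine ⟨?_, ?_, ?_⟩ <;> rw [← norm_eq_zero, ← sq_eq_zero_iff] <;> linarith
  · rintro ⟨rfl, rfl, rfl⟩; simp

end IsUnitaryTriple

end NessSl2

namespace NessSl2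

variable {n : ℕ}

/-! ### The critical point equation -/

/-- The gradient, up to a positive factor, of `K` at `A` along the orbit of `A`. -/
noncomputable def critGrad (A : Matrix (Fin n) (Fin n) ℂ) : Matrix (Fin n) (Fin n) ℂ :=
  (discr A : ℂ) • ⁅A, ⁅Aᴴ, ⁅A, Aᴴ⁆⁆⁆ - (normSq ⁅A, Aᴴ⁆ * normSq A : ℂ) • ⁅A, Aᴴ⁆

theorem isHermitian_critGrad (A : Matrix (Fin n) (Fin n) ℂ) : (critGrad A)ᴴ = critGrad A := by
  have h : ⁅A, ⁅Aᴴ, ⁅A, Aᴴ⁆⁆⁆ᴴ = ⁅A, ⁅Aᴴ, ⁅A, Aᴴ⁆⁆⁆ := by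
    simp only [conjTranspose_lie, conjTranspose_conjTranspose]
    simp only [Ring.lie_def]; noncomm_ring
  simp [critGrad, h, isHermitian_lie_conjTranspose]

theorem trace_critGrad (A : Matrix (Fin n) (Fin n) ℂ) : (critGrad A).trace = 0 := by
  simp [critGrad]

/-- Equality in the Cauchy-Schwarz inequality for `[[A, A*], A]` and the part of `A` orthogonal
to `A*`. -/
theorem lie_lie_eq_of_critGrad_eq_zero {A : Matrix (Fin n) (Fin n) ℂ} (hD : 0 < discr A)
    (h : critGrad A = 0) :
    ⁅⁅A, Aᴴ⁆, A⁆ = (normSq ⁅A, Aᴴ⁆ * normSq A / discr A : ℂ) •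
      (A - ((A ^ 2).trace / normSq A) • Aᴴ) := by
  have hA : A ≠ 0 := by rintro rfl; simp [discr, normSq] at hD
  set μ := ⁅A, Aᴴ⁆ with hμ
  have hμs : μᴴ = μ := isHermitian_lie_conjTranspose A
  have hD0 : (discr A : ℂ) ≠ 0 := by exact_mod_cast hD.ne'
  have h0 : (normSq A : ℂ) ≠ 0 := by exact_mod_cast (normSq_pos.mpr hA).ne'
  rw [critGrad, sub_eq_zero, ← hμ] at h
  set s := (A ^ 2).trace / normSq A with hs
  set A' := A - s • Aᴴ with hA'
  set c : ℂ := normSq μ * normSq A / discr A with hc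
  have hcs : star c = c := by rw [hc]; simp
  -- the three inner products
  have hBt : ⁅μ, A⁆ᴴ = ⁅Aᴴ, μ⁆ := by rw [conjTranspose_lie, hμs]
  have hμμ : (μ * μ).trace = normSq μ := by conv_rhs => rw [ofReal_normSq, hμs]
  -- The critical equation paired with μ.
  have hBB : (⁅μ, A⁆ * ⁅μ, A⁆ᴴ).trace = c * normSq μ := by
    have h1 := congrArg (fun X => (μ * X).trace) h
    simp only [Matrix.mul_smul, trace_smul, smul_eq_mul, hμμ] at h1
    rw [hBt, trace_lie_mul, hc]
    field_simp
    linear_combination h1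
  -- Subtracting s A* from A costs nothing here, because tr([μ, A] A) = 0.
  have hBA : (⁅μ, A⁆ * A'ᴴ).trace = normSq μ := by
    have h2 : (⁅μ, A⁆ * A).trace = 0 := by rw [trace_lie_mul]; simp
    have h3 : (⁅μ, A⁆ * Aᴴ).trace = normSq μ := by rw [trace_lie_mul, ← hμ, hμμ]
    simp [hA', Matrix.mul_sub, h2, h3]
  have hAB : (A' * ⁅μ, A⁆ᴴ).trace = normSq μ := by
    have := congrArg star hBA
    rw [← trace_conjTranspose, conjTranspose_mul, conjTranspose_conjTranspose] at this
    simpa using this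
  have hAA : (normSq A : ℂ) * (A' * A'ᴴ).trace = discr A := by
    rw [← ofReal_normSq, ← normSq_sub_proj A hA]; push_cast; rfl
  -- The three inner products make the squared norm of the difference of the two sides zero.
  rw [← sub_eq_zero, ← normSq_eq_zero, ← Complex.ofReal_eq_zero, ofReal_normSq]
  simp only [conjTranspose_sub, conjTranspose_smul, Matrix.sub_mul, Matrix.mul_sub, trace_sub,
    Matrix.smul_mul, Matrix.mul_smul, trace_smul, smul_eq_mul, hBB, hBA, hAB, hcs]
  have hAA' : (A' * A'ᴴ).trace = discr A / normSq A := by rw [← hAA]; field_simp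
  rw [hAA', hc]
  field_simp
  ring

/-- The elements of the span of a triple form a Lie subalgebra. -/
def IsUnitaryTriple.toLieSubalgebra {H E : Matrix (Fin n) (Fin n) ℂ} (t : IsUnitaryTriple H E) :
    LieSubalgebra ℂ (Matrix (Fin n) (Fin n) ℂ) where
  carrier := {B | ∃ a b c, B = comb H E a b c}
  zero_mem' := ⟨0, 0, 0, by simp [comb]⟩
  add_mem' := by
    rintro _ _ ⟨a, b, c, rfl⟩ ⟨x, y, z, rfl⟩
    exact ⟨a + x, b + y, c + z, by simp only [comb]; module⟩
  smul_mem' := by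
    rintro r _ ⟨a, b, c, rfl⟩
    exact ⟨r * a, r * b, r * c, by simp only [comb]; module⟩
  lie_mem' := by
    rintro _ _ ⟨a, b, c, rfl⟩ ⟨x, y, z, rfl⟩
    exact ⟨_, _, _, t.lie_comb a b c x y z⟩

theorem IsUnitaryTriple.finrank_toLieSubalgebra {H E : Matrix (Fin n) (Fin n) ℂ}
    (t : IsUnitaryTriple H E) (hE : E ≠ 0) : Module.finrank ℂ t.toLieSubalgebra = 3 := by
  have hli : LinearIndependent ℂ ![H, E, Eᴴ] := by
    rw [Fintype.linearIndependent_iff]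
    intro g hg
    rw [Fin.sum_univ_three] at hg
    obtain ⟨h0, h1, h2⟩ := (t.comb_eq_zero_iff hE).mp hg
    intro i; fin_cases i <;> assumption
  have h := finrank_span_eq_card hli
  rw [Fintype.card_fin] at h
  have hspan : t.toLieSubalgebra.toSubmodule = Submodule.span ℂ (Set.range ![H, E, Eᴴ]) := by
    ext B
    rw [Submodule.mem_span_range_iff_exists_fun]
    constructor
    · rintro ⟨a, b, c, rfl⟩
      exact ⟨![a, b, c], by simp [Fin.sum_univ_three, comb]⟩
    · rintro ⟨g, rfl⟩
      exact ⟨g 0, g 1, g 2, by simp [Fin.sum_univ_three, comb]⟩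
  rw [← hspan] at h
  exact h

/-- On the span of A and A*, ad μ acts by A ↦ l (A - s A*), A* ↦ -l (A* - s̄ A), with eigenvalues ±
l r where r² = 1 - |s|². The eigenvector A + β A* for l r, suitably scaled, is E, and H is a
multiple of μ. -/
theorem exists_isUnitaryTriple_of_critGrad_eq_zero {A : Matrix (Fin n) (Fin n) ℂ}
    (hD : 0 < discr A) (hμ0 : ⁅A, Aᴴ⁆ ≠ 0) (h : critGrad A = 0) :
    ∃ H E, ∃ t : IsUnitaryTriple H E, E ≠ 0 ∧ genAlg A = t.toLieSubalgebra := by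
  have hA : A ≠ 0 := by rintro rfl; simp [discr, normSq] at hD
  have hB := lie_lie_eq_of_critGrad_eq_zero hD h
  set μ := ⁅A, Aᴴ⁆ with hμ
  have hμs : μᴴ = μ := isHermitian_lie_conjTranspose A
  have hNA : 0 < normSq A := normSq_pos.mpr hA
  have hNμ : 0 < normSq μ := normSq_pos.mpr hμ0
  set s := (A ^ 2).trace / normSq A with hs
  set l : ℝ := normSq μ * normSq A / discr A with hl
  have hl0 : 0 < l := by positivity
  have hlC : (normSq μ * normSq A / discr A : ℂ) = l := by rw [hl]; push_cast; rfl
  rw [hlC] at hB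
  have hB' : ⁅μ, Aᴴ⁆ = -((l : ℂ) • (Aᴴ - star s • A)) := by
    have := congrArg conjTranspose hB
    rw [conjTranspose_lie, hμs, ← lie_skew, neg_eq_iff_eq_neg] at this
    rw [this]; simp
  -- Positivity of `discr A` is exactly |s| < 1, which makes the eigenvalues real and nonzero.
  have hs1 : ‖s‖ ^ 2 < 1 := by
    rw [hs, norm_div, Complex.norm_real, Real.norm_eq_abs, abs_of_pos hNA, div_pow,
      div_lt_one (by positivity)]
    unfold discr at hD; linarith
  obtain ⟨r, hr0, hr⟩ : ∃ r : ℝ, 0 < r ∧ r ^ 2 = 1 - ‖s‖ ^ 2 :=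
    ⟨√(1 - ‖s‖ ^ 2), Real.sqrt_pos.mpr (by linarith), Real.sq_sqrt (by linarith)⟩
  have hss : s * star s = 1 - (r : ℂ) ^ 2 := by
    rw [RCLike.star_def, Complex.mul_conj, Complex.normSq_eq_norm_sq]
    have : ‖s‖ ^ 2 = 1 - r ^ 2 := by linarith
    rw [this]; push_cast; rfl
  have hr1 : (1 + r : ℂ) ≠ 0 := by
    have : (1 + r : ℝ) ≠ 0 := by positivity
    exact_mod_cast this
  set β : ℂ := -s / (1 + r) with hβ
  have hβs : star β = -star s / (1 + r) := by rw [hβ]; simp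
  -- `|β|² = (1 - r) / (1 + r)`
  have hββ : β * star β = (1 - r) / (1 + r) := by
    rw [hβs, hβ]; field_simp; linear_combination hss
  set E₀ := A + β • Aᴴ with hE₀
  have hE₀s : E₀ᴴ = Aᴴ + star β • A := by simp [hE₀]
  have hμE : ⁅μ, E₀⁆ = (l * r : ℂ) • E₀ := by
    have e1 : 1 + β * star s = r := by rw [hβ]; field_simp; linear_combination -hss
    have e2 : -(s + β) = r * β := by rw [hβ]; field_simp; ring
    rw [hE₀, lie_add, lie_smul, hB, hB']
    calc _ = ((l : ℂ) * (1 + β * star s)) • A + ((l : ℂ) * (-(s + β))) • Aᴴ := by module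
      _ = _ := by rw [e1, e2]; module
  have hEE : ⁅E₀, E₀ᴴ⁆ = (1 - (1 - r) / (1 + r) : ℂ) • μ := by
    have : ⁅Aᴴ, A⁆ = -μ := by rw [hμ, lie_skew]
    rw [hE₀s, hE₀, ← hββ]
    simp only [lie_add, add_lie, lie_smul, smul_lie, lie_self, this, ← hμ]
    module
  have hrC : (r : ℂ) ≠ 0 := by exact_mod_cast hr0.ne'
  have hlC0 : (l : ℂ) ≠ 0 := by exact_mod_cast hl0.ne'
  -- normalization
  set w : ℝ := √((1 + r) / (l * r ^ 2)) with hw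
  have hw0 : 0 < w := Real.sqrt_pos.mpr (by positivity)
  have hww : (w : ℂ) * w = (1 + r) / (l * r ^ 2) := by
    rw [← Complex.ofReal_mul, Real.mul_self_sqrt (by positivity)]; push_cast; rfl
  have hwC : (w : ℂ) ≠ 0 := by exact_mod_cast hw0.ne'
  -- The factor 2 / (l r) turns the eigenvalue l r into 2. As [E₀, E₀*] = 2r / (1 + r) μ, the
  -- relation [E, E*] = H then forces w² = (1 + r) / (l r²).
  set H := (2 / (l * r) : ℂ) • μ with hH
  set E := (w : ℂ) • E₀ with hE
  have hEs : Eᴴ = (w : ℂ) • E₀ᴴ := by simp [hE]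
  have t : IsUnitaryTriple H E := by
    refine ⟨?_, ?_, ?_⟩
    · rw [hH, conjTranspose_smul, hμs]; simp
    · rw [hH, hE, smul_lie, lie_smul, hμE, smul_smul, smul_smul, smul_smul]
      congr 1; field_simp
    · rw [hEs, hE, smul_lie, lie_smul, hEE, smul_smul, smul_smul, hww, hH]
      congr 1; field_simp; ring
  have hμH : μ = (l * r / 2 : ℂ) • H := by
    rw [hH, smul_smul]
    have : (l * r / 2 * (2 / (l * r)) : ℂ) = 1 := by field_simp
    rw [this, one_smul]
  have hE1 : E₀ = (w : ℂ)⁻¹ • E := by rw [hE, smul_smul, inv_mul_cancel₀ hwC, one_smul]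
  have hE2 : E₀ᴴ = (w : ℂ)⁻¹ • Eᴴ := by rw [hEs, smul_smul, inv_mul_cancel₀ hwC, one_smul]
  have hAE : A = ((1 + r) / (2 * r) : ℂ) • (E₀ - β • E₀ᴴ) := by
    have : E₀ - β • E₀ᴴ = (1 - β * star β) • A := by rw [hE₀s, hE₀]; module
    rw [this, smul_smul, hββ]
    have : ((1 + r) / (2 * r) * (1 - (1 - r) / (1 + r)) : ℂ) = 1 := by field_simp; ring
    rw [this, one_smul]
  have hE0 : E ≠ 0 := by
    intro h0
    have h1 := t.lie_e_f
    rw [h0, zero_lie] at h1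
    exact hμ0 (by rw [hμH, ← h1, smul_zero])
  have hAmem : A ∈ t.toLieSubalgebra :=
    ⟨0, (1 + r) / (2 * r) * (w : ℂ)⁻¹, -((1 + r) / (2 * r) * β * (w : ℂ)⁻¹), by
      conv_lhs => rw [hAE, hE1, conjTranspose_smul]
      simp only [comb, star_inv₀, RCLike.star_def, Complex.conj_ofReal]
      module⟩
  have hAsmem : Aᴴ ∈ t.toLieSubalgebra := by
    obtain ⟨a, b, c, habc⟩ := hAmem
    exact ⟨_, _, _, by rw [habc, t.conjTranspose_comb]⟩
  refine ⟨H, E, t, hE0, le_antisymm ?_ ?_⟩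
  · rw [genAlg, LieSubalgebra.lieSpan_le]
    rintro X (rfl | rfl | rfl)
    · exact hAmem
    · exact hAsmem
    · exact t.toLieSubalgebra.lie_mem hAmem hAsmem
  · rintro _ ⟨a, b, c, rfl⟩
    have hsub := LieSubalgebra.subset_lieSpan (R := ℂ) (s := {A, Aᴴ, ⁅A, Aᴴ⁆})
    have m1 : A ∈ genAlg A := hsub (by simp)
    have m2 : Aᴴ ∈ genAlg A := hsub (by simp)
    have m3 : μ ∈ genAlg A := hsub (by simp [hμ])
    have m4 : E ∈ genAlg A :=
      (genAlg A).smul_mem _ ((genAlg A).add_mem m1 ((genAlg A).smul_mem _ m2))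
    have m5 : Eᴴ ∈ genAlg A := by
      rw [hEs, hE₀s]
      exact (genAlg A).smul_mem _ ((genAlg A).add_mem m2 ((genAlg A).smul_mem _ m1))
    have m6 : H ∈ genAlg A := (genAlg A).smul_mem _ m3
    exact (genAlg A).add_mem ((genAlg A).add_mem ((genAlg A).smul_mem _ m6)
      ((genAlg A).smul_mem _ m4)) ((genAlg A).smul_mem _ m5)

end NessSl2

namespace NessSl2

/-! ### The standard representations -/

section Irrep

variable (m : ℕ)

/-- The matrix `e_m`. -/
noncomputable def irrepE : Matrix (Fin m) (Fin m) ℂ :=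
  of fun i j => if (j : ℕ) = i + 1 then (Real.sqrt ((j : ℝ) * ((m : ℝ) - j)) : ℂ) else 0

/-- The matrix `x_m`. -/
noncomputable def irrepH : Matrix (Fin m) (Fin m) ℂ :=
  diagonal fun i => (m : ℂ) - 1 - 2 * (i : ℂ)

theorem irrep_eq (M : Matrix (Fin 2) (Fin 2) ℂ) :
    irrep m M = M 0 0 • irrepH m + M 0 1 • irrepE m + M 1 0 • (irrepE m)ᴴ := by
  ext i j
  simp only [irrep, irrepE, irrepH, of_apply, Matrix.add_apply, Matrix.smul_apply,
    conjTranspose_apply, diagonal_apply, smul_eq_mul]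
  by_cases h1 : (j : ℕ) = i + 1
  · have h2 : ¬ (i : ℕ) = j + 1 := by lia
    have h3 : i ≠ j := by rintro rfl; lia
    rw [if_pos h1, if_neg h3, if_pos h1, if_neg h2]
    simp
  · by_cases h2 : (i : ℕ) = j + 1
    · have h3 : i ≠ j := by rintro rfl; lia
      rw [if_neg h1, if_pos h2, if_neg h3, if_neg h1, if_pos h2]
      simp
    · by_cases h3 : i = j
      · simp [h3]
      · simp [h1, h2, h3]

theorem irrepE_mul_conjTranspose :
    irrepE m * (irrepE m)ᴴ = diagonal fun i : Fin m => (((i : ℕ) : ℂ) + 1) * ((m : ℂ) - (i : ℕ) - 1) := by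
  ext i j
  simp only [mul_apply, irrepE, of_apply, conjTranspose_apply, diagonal_apply]
  by_cases hij : i = j
  · subst hij
    by_cases hi : (i : ℕ) + 1 < m
    · rw [Finset.sum_eq_single ⟨i + 1, hi⟩]
      · have : (0 : ℝ) ≤ (((i : ℕ) + 1 : ℕ) : ℝ) * ((m : ℝ) - ((i + 1 : ℕ) : ℝ)) :=
          mul_nonneg (Nat.cast_nonneg _) (sub_nonneg.mpr (by exact_mod_cast hi.le))
        simp only [if_true, RCLike.star_def, Complex.conj_ofReal]
        rw [← Complex.ofReal_mul, Real.mul_self_sqrt this]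
        push_cast; ring
      · intro k _ hk
        have : ¬ (k : ℕ) = i + 1 := fun h => hk (Fin.ext h)
        simp [this]
      · simp
    -- In the last row there is no superdiagonal entry, and the formula vanishes because m = i + 1.
    · have him : (m : ℂ) = i + 1 := by
        have : m = i + 1 := by lia
        exact_mod_cast this
      rw [Finset.sum_eq_zero, if_pos rfl, him]
      · ring
      · intro k _
        have : ¬ (k : ℕ) = i + 1 := by lia
        simp [this]
  · rw [if_neg hij]
    refine Finset.sum_eq_zero fun k _ => ?_
    by_cases h1 : (k : ℕ) = i + 1
    · have : ¬ (k : ℕ) = j + 1 := fun h => hij (Fin.ext (by lia))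
      simp [this]
    · simp [h1]

theorem conjTranspose_mul_irrepE :
    (irrepE m)ᴴ * irrepE m = diagonal fun i : Fin m => ((i : ℕ) : ℂ) * ((m : ℂ) - (i : ℕ)) := by
  ext i j
  simp only [mul_apply, irrepE, of_apply, conjTranspose_apply, diagonal_apply]
  by_cases hij : i = j
  · subst hij
    rcases Nat.eq_zero_or_pos (i : ℕ) with hi | hi
    · rw [Finset.sum_eq_zero, if_pos rfl, hi]
      · simp
      · intro k _
        have : ¬ (i : ℕ) = k + 1 := by lia
        simp [this]
    · have hi1 : (i : ℕ) = (i - 1 : ℕ) + 1 := by lia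
      rw [Finset.sum_eq_single ⟨i - 1, by lia⟩]
      · have : (0 : ℝ) ≤ (i : ℝ) * ((m : ℝ) - (i : ℝ)) :=
          mul_nonneg (Nat.cast_nonneg _) (sub_nonneg.mpr (by exact_mod_cast i.2.le))
        simp only [if_true, RCLike.star_def, if_pos hi1, Complex.conj_ofReal]
        rw [← Complex.ofReal_mul, Real.mul_self_sqrt this]
        push_cast; ring
      · intro k _ hk
        have : ¬ (i : ℕ) = k + 1 := fun h => hk (Fin.ext (by simp only; lia))
        simp [this]
      · simp
  · rw [if_neg hij]
    refine Finset.sum_eq_zero fun k _ => ?_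
    by_cases h1 : (i : ℕ) = k + 1
    · have : ¬ (j : ℕ) = k + 1 := fun h => hij (Fin.ext (by lia))
      simp [this]
    · simp [h1]

theorem irrepE_mul_sub : irrepE m * (irrepE m)ᴴ - (irrepE m)ᴴ * irrepE m = irrepH m := by
  rw [irrepE_mul_conjTranspose, conjTranspose_mul_irrepE, irrepH, diagonal_sub]
  refine congrArg diagonal (funext fun i => ?_); ring

theorem irrepH_mul_sub : irrepH m * irrepE m - irrepE m * irrepH m = (2 : ℂ) • irrepE m := by
  ext i j
  simp only [irrepH, irrepE, Matrix.sub_apply, diagonal_mul, mul_diagonal, of_apply,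
    Matrix.smul_apply, smul_eq_mul]
  split_ifs with h
  · rw [h]; push_cast; ring
  · simp

theorem sum_weight_sq : ∑ i : Fin m, ((m : ℝ) - 1 - 2 * (i : ℕ)) ^ 2 = (m : ℝ) * (m ^ 2 - 1) / 3 := by
  rw [Fin.sum_univ_eq_sum_range fun i : ℕ => ((m : ℝ) - 1 - 2 * i) ^ 2]
  -- The size m occurs both in the summand and in the range; separating the two makes induction
  -- possible.
  have h (x : ℝ) (k : ℕ) : ∑ i ∈ Finset.range k, (x - 2 * (i : ℝ)) ^ 2 =
      k * x ^ 2 - 2 * x * (k * (k - 1)) + 2 * (k * (k - 1) * (2 * k - 1)) / 3 := by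
    induction k with
    | zero => simp
    | succ k ih => rw [Finset.sum_range_succ, ih]; push_cast; ring
  rw [h]; ring

end Irrep

variable {n : ℕ} (π : n.Partition)

/-- The weight of the `i`-th basis vector for `j_π`. -/
noncomputable def weight (i : Fin n) : ℝ :=
  (((sortedParts π).get ((blockEquiv π).symm i).1 : ℕ) : ℝ) - 1 -
    2 * ((((blockEquiv π).symm i).2 : ℕ) : ℝ)

/-- The semisimple element `j_π(x)`. -/
noncomputable def stdH : Matrix (Fin n) (Fin n) ℂ :=
  diagonal fun i => (weight π i : ℂ)

theorem stdRep_eq (M : Matrix (Fin 2) (Fin 2) ℂ) :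
    stdRep π M = M 0 0 • (blockDiagonal' fun p => irrepH ((sortedParts π).get p)).submatrix
        (blockEquiv π).symm (blockEquiv π).symm +
      M 0 1 • (blockDiagonal' fun p => irrepE ((sortedParts π).get p)).submatrix
        (blockEquiv π).symm (blockEquiv π).symm +
      M 1 0 • (blockDiagonal' fun p => (irrepE ((sortedParts π).get p))ᴴ).submatrix
        (blockEquiv π).symm (blockEquiv π).symm := by
  have h : (fun p => irrep ((sortedParts π).get p) M) =
      M 0 0 • (fun p => irrepH ((sortedParts π).get p)) +
      M 0 1 • (fun p => irrepE ((sortedParts π).get p)) +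
      M 1 0 • fun p => (irrepE ((sortedParts π).get p))ᴴ := by
    funext p; exact irrep_eq _ M
  rw [stdRep, h, blockDiagonal'_add, blockDiagonal'_add, blockDiagonal'_smul, blockDiagonal'_smul,
    blockDiagonal'_smul]
  rfl

theorem stdE_eq : stdE π = (blockDiagonal' fun p => irrepE ((sortedParts π).get p)).submatrix
    (blockEquiv π).symm (blockEquiv π).symm := by
  rw [stdE, stdRep_eq]; simp

theorem conjTranspose_stdE :
    (stdE π)ᴴ = (blockDiagonal' fun p => (irrepE ((sortedParts π).get p))ᴴ).submatrix
      (blockEquiv π).symm (blockEquiv π).symm := by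
  rw [stdE_eq, conjTranspose_submatrix, blockDiagonal'_conjTranspose]

theorem stdH_eq : stdH π = (blockDiagonal' fun p => irrepH ((sortedParts π).get p)).submatrix
    (blockEquiv π).symm (blockEquiv π).symm := by
  simp only [irrepH, blockDiagonal'_diagonal, submatrix_diagonal_equiv, stdH]
  congr 1; ext i; simp [weight]

theorem stdRep_eq_comb (M : Matrix (Fin 2) (Fin 2) ℂ) :
    stdRep π M = comb (stdH π) (stdE π) (M 0 0) (M 0 1) (M 1 0) := by
  rw [stdRep_eq, comb, stdH_eq, conjTranspose_stdE, ← stdE_eq]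

theorem isUnitaryTriple_std : IsUnitaryTriple (stdH π) (stdE π) where
  isHermitian := by
    rw [stdH, diagonal_conjTranspose]; congr 1; ext i; simp
  lie_h_e := by
    have h : (blockDiagonal' fun p => irrepH ((sortedParts π).get p)) *
          (blockDiagonal' fun p => irrepE ((sortedParts π).get p)) -
        (blockDiagonal' fun p => irrepE ((sortedParts π).get p)) *
          (blockDiagonal' fun p => irrepH ((sortedParts π).get p)) =
        (2 : ℂ) • blockDiagonal' fun p => irrepE ((sortedParts π).get p) := by
      rw [← blockDiagonal'_mul, ← blockDiagonal'_mul, ← blockDiagonal'_sub, ← blockDiagonal'_smul]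
      congr 1; funext p; exact irrepH_mul_sub _
    rw [stdH_eq, stdE_eq, Ring.lie_def, submatrix_mul_equiv, submatrix_mul_equiv]
    exact congrArg (fun X => X.submatrix (blockEquiv π).symm (blockEquiv π).symm) h
  lie_e_f := by
    have h : (blockDiagonal' fun p => irrepE ((sortedParts π).get p)) *
          (blockDiagonal' fun p => (irrepE ((sortedParts π).get p))ᴴ) -
        (blockDiagonal' fun p => (irrepE ((sortedParts π).get p))ᴴ) *
          (blockDiagonal' fun p => irrepE ((sortedParts π).get p)) =
        blockDiagonal' fun p => irrepH ((sortedParts π).get p) := by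
      rw [← blockDiagonal'_mul, ← blockDiagonal'_mul, ← blockDiagonal'_sub]
      congr 1; funext p; exact irrepE_mul_sub _
    rw [stdH_eq, conjTranspose_stdE, stdE_eq, Ring.lie_def, submatrix_mul_equiv,
      submatrix_mul_equiv]
    exact congrArg (fun X => X.submatrix (blockEquiv π).symm (blockEquiv π).symm) h

theorem mem_stdSl2_iff {B : Matrix (Fin n) (Fin n) ℂ} :
    B ∈ stdSl2 π ↔ ∃ a b c, B = comb (stdH π) (stdE π) a b c := by
  constructor
  · rintro ⟨M, -, rfl⟩; exact ⟨_, _, _, stdRep_eq_comb π M⟩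
  · rintro ⟨a, b, c, rfl⟩
    exact ⟨!![a, b; c, -a], by simp [trace_fin_two], by simp [stdRep_eq_comb]⟩

theorem normSq_diagonal (d : Fin n → ℝ) : normSq (diagonal fun i => (d i : ℂ)) = ∑ i, d i ^ 2 := by
  rw [normSq_eq_sum]
  refine Finset.sum_congr rfl fun i _ => ?_
  rw [Finset.sum_eq_single i]
  · simp
  · intro j _ hj; simp [diagonal_apply_ne' _ hj]
  · simp

/-- Squared weights summed block by block; combined with K = 4 / |H|² this is the origin of the 12
in the constant. -/
theorem normSq_stdH :
    normSq (stdH π) = (π.parts.map fun m : ℕ => (m : ℝ) * ((m : ℝ) ^ 2 - 1)).sum / 3 := by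
  have h1 : (π.parts.map fun m : ℕ => (m : ℝ) * ((m : ℝ) ^ 2 - 1)) =
      (((sortedParts π).map fun m : ℕ => (m : ℝ) * ((m : ℝ) ^ 2 - 1) : List ℝ) : Multiset ℝ) := by
    rw [← Multiset.map_coe, sortedParts, Multiset.sort_eq]
  rw [stdH, normSq_diagonal, h1, Multiset.sum_coe, ← Fin.sum_univ_fun_getElem,
    ← (blockEquiv π).sum_comp, Fintype.sum_sigma, Finset.sum_div]
  refine Finset.sum_congr rfl fun p _ => ?_
  rw [← List.get_eq_getElem, ← sum_weight_sq]
  refine Finset.sum_congr rfl fun x _ => ?_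
  rw [weight, Equiv.symm_apply_apply]

end NessSl2

namespace NessSl2

/-! ### Unitary representations of `sl(2)` -/

section UnitaryRep

open Module InnerProductSpace

variable {V : Type*} [NormedAddCommGroup V] [InnerProductSpace ℂ V] [FiniteDimensional ℂ V]
  {e f h : Module.End ℂ V}

/-- `e` is injective on a subspace stable under `e` and `h` only if the subspace vanishes. -/
theorem eq_bot_of_disjoint_ker (hef : h * e - e * h = (2 : ℂ) • e) {T : Submodule ℂ V}
    (heT : ∀ x ∈ T, e x ∈ T) (hhT : ∀ x ∈ T, h x ∈ T) (hker : ∀ x ∈ T, e x = 0 → x = 0) :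
    T = ⊥ := by
  set e' := e.restrict heT
  set h' := h.restrict hhT
  have hrel : h' * e' - e' * h' = (2 : ℂ) • e' := by
    ext x
    exact LinearMap.congr_fun hef x
  have hinj : Function.Injective e' := by
    rw [← LinearMap.ker_eq_bot, LinearMap.ker_eq_bot']
    intro x hx
    exact Subtype.ext (hker x x.2 (congrArg Subtype.val hx))
  set u := LinearEquiv.ofInjectiveEndo e' hinj
  have hu1 : (u.symm : Module.End ℂ T) * e' = 1 := by
    ext x; exact congrArg Subtype.val (LinearEquiv.ofInjectiveEndo_left_inv e' hinj ▸ rfl)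
  -- After multiplication by the inverse of e', the commutator has trace 0 by cyclicity, while the
  -- right side has trace 2 dim T.
  have h1 := congrArg (fun X => LinearMap.trace ℂ T ((u.symm : Module.End ℂ T) * X)) hrel
  simp only [mul_sub, map_sub, mul_smul_comm, map_smul, hu1] at h1
  rw [← mul_assoc, ← mul_assoc, hu1, one_mul, LinearMap.trace_mul_comm, ← mul_assoc,
    LinearMap.trace_mul_comm] at h1
  have hu2 : e' * (u.symm : Module.End ℂ T) = 1 := mul_eq_one_comm.mp hu1
  rw [hu2, mul_one, sub_self, LinearMap.trace_one] at h1
  simpa using h1.symm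

/-- The operator h is symmetric and preserves ker e, so ker e has an orthonormal basis of primitive
vectors. Applying powers of f and normalizing gives the strings. Adjointness of e and f yields their
orthogonality and norms, hence the square roots. They span because a nonzero orthogonal complement
would meet ker e. -/
theorem exists_string_basis (t : IsSl2Triple h e f) (hadj : ∀ x y, ⟪e x, y⟫_ℂ = ⟪x, f y⟫_ℂ) :
    ∃ (r : ℕ) (N : Fin r → ℕ) (b : OrthonormalBasis (Σ p : Fin r, Fin (N p + 1)) ℂ V),
      (∀ p k (hk : k + 1 < N p + 1), e (b ⟨p, ⟨k + 1, hk⟩⟩) =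
        ((√(((k : ℝ) + 1) * ((N p : ℝ) - k)) : ℝ) : ℂ) • b ⟨p, ⟨k, by lia⟩⟩) ∧
      ∀ p, e (b ⟨p, 0⟩) = 0 := by
  have hef : h * e - e * h = (2 : ℂ) • e := by
    rw [← Ring.lie_def, t.lie_h_e_smul ℂ]
  have hadj' : ∀ x y, ⟪f x, y⟫_ℂ = ⟪x, e y⟫_ℂ := fun x y => by
    rw [← inner_conj_symm, ← hadj, inner_conj_symm]
  have hef' : h = e * f - f * e := by rw [← Ring.lie_def, t.lie_e_f]
  have hsymm : h.IsSymmetric := fun x y => by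
    simp only [hef', LinearMap.sub_apply, Module.End.mul_apply, inner_sub_left, inner_sub_right,
      hadj, hadj']
  have hW : ∀ x ∈ LinearMap.ker e, h x ∈ LinearMap.ker e := fun x hx => by
    have := LinearMap.congr_fun hef x
    simp only [LinearMap.sub_apply, Module.End.mul_apply, LinearMap.smul_apply,
      LinearMap.mem_ker.mp hx, map_zero, smul_zero, zero_sub, neg_eq_zero] at this
    exact this
  have hWs := hsymm.restrict_invariant hW
  set r := finrank ℂ (LinearMap.ker e)
  set w := hWs.eigenvectorBasis (rfl : _ = r)
  let v : Fin r → V := fun p => (w p : V)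
  have hv0 : ∀ p, v p ≠ 0 := fun p h0 => w.orthonormal.ne_zero p (Subtype.ext h0)
  have hvh : ∀ p, h (v p) = (hWs.eigenvalues (rfl : _ = r) p : ℂ) • v p := fun p =>
    congrArg Subtype.val (hWs.hasEigenvector_eigenvectorBasis (rfl : _ = r) p).apply_eq_smul
  have hP : ∀ p, t.HasPrimitiveVectorWith (v p) (hWs.eigenvalues (rfl : _ = r) p : ℂ) := fun p =>
    ⟨hv0 p, hvh p, (w p).2⟩
  choose N hN using fun p => (hP p).exists_nat
  let u : Fin r → ℕ → V := fun p k => (f ^ k) (v p)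
  have hfu : ∀ p k, f (u p k) = u p (k + 1) := fun p k => by
    simp only [u, pow_succ', Module.End.mul_apply]
  have heu0 : ∀ p, e (u p 0) = 0 := fun p => (w p).2
  have heu : ∀ p k, e (u p (k + 1)) = (((k : ℂ) + 1) * (N p - k)) • u p k := fun p k => by
    rw [← hN]; exact (hP p).lie_e_pow_succ_toEnd_f k
  have huN : ∀ p, u p (N p + 1) = 0 := fun p => (hP p).pow_toEnd_f_eq_zero_of_eq_nat (hN p)
  have hhu : ∀ p k, h (u p k) = ((N p : ℂ) - 2 * k) • u p k := fun p k => by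
    rw [← hN]; exact (hP p).lie_h_pow_toEnd_f k
  have huu : ∀ p q k l, ⟪u p (k + 1), u q (l + 1)⟫_ℂ =
      (((l : ℂ) + 1) * (N q - l)) * ⟪u p k, u q l⟫_ℂ := fun p q k l => by
    rw [← hfu p, hadj', heu, inner_smul_right]
  have hu0 : ∀ p q l, ⟪u p 0, u q (l + 1)⟫_ℂ = 0 := fun p q l => by
    rw [← hfu q, ← hadj, heu0, inner_zero_left]
  have hu0' : ∀ p q l, ⟪u q (l + 1), u p 0⟫_ℂ = 0 := fun p q l => by
    rw [← inner_conj_symm, hu0, map_zero]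
  -- Moving one f across the inner product lowers both indices by one, until one of them is 0.
  have horth : ∀ k l p q, (p ≠ q ∨ k ≠ l) → ⟪u p k, u q l⟫_ℂ = 0 := by
    intro k
    induction k with
    | zero =>
      rintro (_ | l) p q hpq
      · exact w.orthonormal.2 (hpq.resolve_right (by simp))
      · exact hu0 p q l
    | succ k ih =>
      rintro (_ | l) p q hpq
      · exact hu0' q p k
      · rw [huu, ih l p q (hpq.imp_right (by simp)), mul_zero]
  have hnorm : ∀ p k, ‖u p (k + 1)‖ ^ 2 = (((k : ℝ) + 1) * ((N p : ℝ) - k)) * ‖u p k‖ ^ 2 :=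
    fun p k => by
      have := huu p p k k
      rw [inner_self_eq_norm_sq_to_K, inner_self_eq_norm_sq_to_K] at this
      apply Complex.ofReal_injective
      push_cast
      exact this
  have hune : ∀ p k, k ≤ N p → u p k ≠ 0 := fun p k hk =>
    (hP p).pow_toEnd_f_ne_zero_of_eq_nat (hN p) hk
  let b₀ : (Σ p : Fin r, Fin (N p + 1)) → V := fun i => ((‖u i.1 i.2‖ : ℂ)⁻¹) • u i.1 i.2
  have hub : ∀ p (k : Fin (N p + 1)), u p k = (‖u p k‖ : ℂ) • b₀ ⟨p, k⟩ := fun p k => by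
    have : (‖u p k‖ : ℂ) ≠ 0 := by
      exact_mod_cast norm_ne_zero_iff.mpr (hune p k (by lia))
    simp only [b₀, smul_smul, mul_inv_cancel₀ this, one_smul]
  have hon : Orthonormal ℂ b₀ := by
    constructor
    · rintro ⟨p, k⟩
      have : ‖u p k‖ ≠ 0 := norm_ne_zero_iff.mpr (hune p k (by lia))
      simp only [b₀, norm_smul, norm_inv, Complex.norm_real, norm_norm, inv_mul_cancel₀ this]
    · rintro ⟨p, k⟩ ⟨q, l⟩ hne
      have : p ≠ q ∨ (k : ℕ) ≠ l := by
        by_contra! hc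
        obtain ⟨rfl, hc⟩ := hc
        exact hne (by rw [Fin.ext hc])
      simp only [b₀, inner_smul_left, inner_smul_right, horth _ _ _ _ this, mul_zero]
  set S := Submodule.span ℂ (Set.range b₀) with hS
  have hmem : ∀ p k, u p k ∈ S := fun p k => by
    by_cases hk : k < N p + 1
    · rw [show k = ((⟨k, hk⟩ : Fin (N p + 1)) : ℕ) from rfl, hub]
      exact S.smul_mem _ (Submodule.subset_span ⟨_, rfl⟩)
    · obtain ⟨j, rfl⟩ := Nat.exists_eq_add_of_le (not_lt.mp hk)
      have : u p (N p + 1 + j) = 0 := by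
        simp only [u, add_comm (N p + 1) j, pow_add f j, Module.End.mul_apply]
        rw [show (f ^ (N p + 1)) (v p) = 0 from huN p, map_zero]
      rw [this]; exact S.zero_mem
  have hstable : ∀ g : Module.End ℂ V, (∀ p k, g (u p k) ∈ S) → ∀ x ∈ S, g x ∈ S := by
    intro g hg x hx
    induction hx using Submodule.span_induction with
    | mem x hx =>
      obtain ⟨⟨p, k⟩, rfl⟩ := hx
      simp only [b₀, map_smul]
      exact S.smul_mem _ (hg p k)
    | zero => rw [map_zero]; exact S.zero_mem
    | add x y _ _ hx hy => rw [map_add]; exact S.add_mem hx hy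
    | smul a x _ hx => rw [map_smul]; exact S.smul_mem _ hx
  have hSf : ∀ x ∈ S, f x ∈ S := hstable f fun p k => by rw [hfu]; exact hmem _ _
  have hSh : ∀ x ∈ S, h x ∈ S := hstable h fun p k => by rw [hhu]; exact S.smul_mem _ (hmem _ _)
  -- The complement is stable under e and h, and ker e lies in S, so `eq_bot_of_disjoint_ker`
  -- applies.
  have hbot : Sᗮ = ⊥ := by
    refine eq_bot_of_disjoint_ker hef ?_ ?_ ?_
    · intro x hx
      rw [Submodule.mem_orthogonal] at hx ⊢
      intro y hy
      rw [← hadj']; exact hx _ (hSf y hy)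
    · intro x hx
      rw [Submodule.mem_orthogonal] at hx ⊢
      intro y hy
      rw [← hsymm y x]; exact hx _ (hSh y hy)
    · intro x hx hex
      have hxS : x ∈ S := by
        have hsum : ((∑ p, w.repr ⟨x, hex⟩ p • w p : LinearMap.ker e) : V) ∈ S := by
          rw [Submodule.coe_sum]
          exact S.sum_mem fun p _ => S.smul_mem _ (hmem p 0)
        rwa [w.sum_repr] at hsum
      have := (Submodule.mem_orthogonal _ _).mp hx x hxS
      exact inner_self_eq_zero.mp this
  have htop : ⊤ ≤ S := by rw [← Submodule.orthogonal_eq_bot_iff.mp hbot]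
  refine ⟨r, N, OrthonormalBasis.mk hon htop, ?_, ?_⟩
  · intro p k hk
    rw [OrthonormalBasis.coe_mk]
    have hc : (0 : ℝ) ≤ ((k : ℝ) + 1) * ((N p : ℝ) - k) :=
      mul_nonneg (by positivity) (sub_nonneg.mpr (by exact_mod_cast (show k ≤ N p by lia)))
    set c := √(((k : ℝ) + 1) * ((N p : ℝ) - k)) with hcdef
    have hcc : c * c = ((k : ℝ) + 1) * ((N p : ℝ) - k) := Real.mul_self_sqrt hc
    have hn : ‖u p (k + 1)‖ = c * ‖u p k‖ := by
      rw [← sq_eq_sq₀ (norm_nonneg _) (by positivity), hnorm, mul_pow, sq c, hcc]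
    have h1 : ‖u p (k + 1)‖ ≠ 0 := norm_ne_zero_iff.mpr (hune p _ (by lia))
    have h2 : ‖u p k‖ ≠ 0 := norm_ne_zero_iff.mpr (hune p _ (by lia))
    have h3 : c ≠ 0 := by rintro h0; rw [hn, h0, zero_mul] at h1; exact h1 rfl
    have hccC : ((k : ℂ) + 1) * ((N p : ℂ) - k) = (c : ℂ) * c := by
      rw [← Complex.ofReal_mul, hcc]; push_cast; ring
    have h2C : (‖u p k‖ : ℂ) ≠ 0 := by exact_mod_cast h2
    have h3C : (c : ℂ) ≠ 0 := by exact_mod_cast h3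
    simp only [b₀, map_smul, heu, hn, smul_smul, hccC]
    congr 1
    push_cast
    field_simp
  · intro p
    rw [OrthonormalBasis.coe_mk]
    simp only [b₀, map_smul]
    rw [show ((0 : Fin (N p + 1)) : ℕ) = 0 from rfl, heu0, smul_zero]

end UnitaryRep

/-- Needed because the strings come in no particular order, whereas the blocks of a standard
representation are sorted. -/
theorem exists_equiv_of_map_univ_eq {α β γ : Type*} [Fintype α] [Fintype β] [DecidableEq γ]
    {f : α → γ} {g : β → γ} (h : Finset.univ.val.map f = Finset.univ.val.map g) :
    ∃ σ : α ≃ β, ∀ a, g (σ a) = f a := by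
  have hc : ∀ c, Fintype.card {a // f a = c} = Fintype.card {b // g b = c} := fun c => by
    have := congrArg (Multiset.count c) h
    rw [Multiset.count_map, Multiset.count_map] at this
    rw [Fintype.card_subtype, Fintype.card_subtype]
    simpa [Finset.card, eq_comm] using this
  let E : ∀ c, {a // f a = c} ≃ {b // g b = c} := fun c => Fintype.equivOfCardEq (hc c)
  refine ⟨(Equiv.sigmaFiberEquiv f).symm.trans
    ((Equiv.sigmaCongrRight E).trans (Equiv.sigmaFiberEquiv g)), fun a => ?_⟩
  exact (E (f a) ⟨a, rfl⟩).2

end NessSl2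

/-! ### Conjugating unitary triples to standard ones -/

namespace NessSl2

variable {n : ℕ}

/-- Scaling U by an n-th root of 1 / det U, which has modulus one, makes it special without changing
the conjugation. For n = 0 there is nothing to scale. -/
theorem exists_specialUnitary_conj_eq {U : Matrix (Fin n) (Fin n) ℂ}
    (hU : U ∈ unitaryGroup (Fin n) ℂ) :
    ∃ U' ∈ specialUnitaryGroup (Fin n) ℂ, ∀ B, U' * B * U'ᴴ = U * B * Uᴴ := by
  rcases Nat.eq_zero_or_pos n with rfl | hn
  · exact ⟨U, mem_specialUnitaryGroup_iff.mpr ⟨hU, by simp⟩, fun _ => rfl⟩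
  have hd : ‖U.det‖ = 1 := by
    have := det_of_mem_unitary hU
    rw [Unitary.mem_iff_self_mul_star, RCLike.star_def, Complex.mul_conj,
      Complex.normSq_eq_norm_sq] at this
    have h2 : ‖U.det‖ ^ 2 = 1 := by exact_mod_cast this
    exact (pow_eq_one_iff_of_nonneg (norm_nonneg _) two_ne_zero).mp h2
  obtain ⟨c, hc⟩ := IsAlgClosed.exists_pow_nat_eq (U.det)⁻¹ hn
  have hc1 : ‖c‖ = 1 := by
    have := congrArg norm hc
    rw [norm_pow, norm_inv, hd, inv_one] at this
    exact (pow_eq_one_iff_of_nonneg (norm_nonneg _) hn.ne').mp this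
  have hcc : c * star c = 1 := by
    rw [RCLike.star_def, Complex.mul_conj, Complex.normSq_eq_norm_sq, hc1]; simp
  refine ⟨c • U, mem_specialUnitaryGroup_iff.mpr ⟨?_, ?_⟩, fun B => ?_⟩
  · rw [mem_unitaryGroup_iff, star_eq_conjTranspose, conjTranspose_smul, Matrix.smul_mul,
      Matrix.mul_smul, smul_smul, hcc, one_smul, ← star_eq_conjTranspose]
    exact mem_unitaryGroup_iff.mp hU
  · rw [det_smul, Fintype.card_fin, hc, inv_mul_cancel₀]
    rw [← norm_ne_zero_iff, hd]; exact one_ne_zero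
  · rw [conjTranspose_smul, Matrix.smul_mul, Matrix.smul_mul, Matrix.mul_smul, smul_smul, hcc,
      one_smul]

/-- The columns of U are the string basis, rearranged so that string lengths match the sorted parts.
-/
theorem IsUnitaryTriple.exists_unitary_conj_stdE {H E : Matrix (Fin n) (Fin n) ℂ}
    (t : IsUnitaryTriple H E) (hE : E ≠ 0) :
    ∃ U ∈ unitaryGroup (Fin n) ℂ, ∃ π : n.Partition, E * U = U * stdE π := by
  have hmul : ∀ X Y : Matrix (Fin n) (Fin n) ℂ,
      toEuclideanLin (X * Y) = (toEuclideanLin X * toEuclideanLin Y :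
        Module.End ℂ (EuclideanSpace ℂ (Fin n))) := fun X Y => by
    ext x; simp [toLpLin_apply, mulVec_mulVec]
  have hH : H ≠ 0 := by
    rintro rfl
    have := t.lie_h_e
    rw [zero_lie] at this
    exact hE (by simpa using this.symm)
  have hs : IsSl2Triple (toEuclideanLin H : Module.End ℂ (EuclideanSpace ℂ (Fin n)))
      (toEuclideanLin E) (toEuclideanLin Eᴴ) := by
    refine ⟨?_, ?_, ?_, ?_⟩
    · simpa using hH
    · rw [Ring.lie_def, ← hmul, ← hmul, ← map_sub, ← Ring.lie_def, t.lie_e_f]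
    · rw [Ring.lie_def, ← hmul, ← hmul, ← map_sub, ← Ring.lie_def, t.lie_h_e, two_smul, two_smul,
        map_add]
    · rw [Ring.lie_def, ← hmul, ← hmul, ← map_sub, ← Ring.lie_def, t.lie_h_f, neg_smul, two_smul,
        two_smul, map_neg, map_add]
  obtain ⟨r, N, b, hb1, hb0⟩ := exists_string_basis hs fun x y => by
    rw [toEuclideanLin_conjTranspose_eq_adjoint, LinearMap.adjoint_inner_right]
  have hcard : ∑ p, (N p + 1) = n := by
    have h1 := Module.finrank_eq_card_basis b.toBasis
    rw [finrank_euclideanSpace_fin, Fintype.card_sigma] at h1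
    simpa using h1.symm
  let π : n.Partition :=
    { parts := Finset.univ.val.map fun p => N p + 1
      parts_pos := by
        intro i hi
        obtain ⟨p, -, rfl⟩ := Multiset.mem_map.mp hi
        exact Nat.succ_pos _
      parts_sum := hcard }
  obtain ⟨σ, hσ⟩ := exists_equiv_of_map_univ_eq (f := (sortedParts π).get) (g := fun p => N p + 1) (by
    rw [Fin.univ_val_map, List.ofFn_get, sortedParts, Multiset.sort_eq])
  let Θ : Fin n ≃ Σ p : Fin r, Fin (N p + 1) :=
    (blockEquiv π).symm.trans (Equiv.sigmaCongr σ fun i => finCongr (hσ i).symm)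
  let b' := b.reindex Θ.symm
  let U : Matrix (Fin n) (Fin n) ℂ := of fun a j => b' j a
  have hU : ∀ a q l, U a (blockEquiv π ⟨q, l⟩) = b ⟨σ q, finCongr (hσ q).symm l⟩ a := by
    intro a q l
    simp only [U, b', Θ, of_apply, OrthonormalBasis.reindex_apply, Equiv.symm_symm,
      Equiv.trans_apply, Equiv.symm_apply_apply]
    rfl
  refine ⟨U, ?_, π, ?_⟩
  · have := (EuclideanSpace.basisFun (Fin n) ℂ).toMatrix_orthonormalBasis_mem_unitary b'
    convert this using 1
    ext a j
    simp [U, Module.Basis.toMatrix_apply]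
  · ext a j
    obtain ⟨⟨p, k⟩, rfl⟩ := (blockEquiv π).surjective j
    have hL : (E * U) a (blockEquiv π ⟨p, k⟩) =
        (toEuclideanLin E (b ⟨σ p, finCongr (hσ p).symm k⟩)) a := by
      simp only [mul_apply, hU, toLpLin_apply, mulVec, dotProduct]
    have hR : (U * stdE π) a (blockEquiv π ⟨p, k⟩) = ∑ l : Fin ((sortedParts π).get p),
        b ⟨σ p, finCongr (hσ p).symm l⟩ a * irrepE _ l k := by
      rw [mul_apply, ← (blockEquiv π).sum_comp, Fintype.sum_sigma, Finset.sum_eq_single p]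
      · refine Finset.sum_congr rfl fun l _ => ?_
        rw [hU, stdE_eq, submatrix_apply, Equiv.symm_apply_apply, Equiv.symm_apply_apply,
          blockDiagonal'_apply_eq]
      · intro q _ hq
        refine Finset.sum_eq_zero fun l _ => ?_
        simp [stdE_eq, blockDiagonal'_apply_ne _ _ _ hq]
      · simp
    rw [hL, hR]
    have hm : (sortedParts π).get p = N (σ p) + 1 := (hσ p).symm
    obtain ⟨k, hk⟩ := k
    rcases k with _ | k
    · rw [Finset.sum_eq_zero]
      · have := hb0 (σ p)
        rw [show (finCongr (hσ p).symm ⟨0, hk⟩) = 0 from Fin.ext rfl, this]; rfl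
      · intro l _
        simp [irrepE]
    · have hk' : k + 1 < N (σ p) + 1 := by lia
      have h1 := hb1 (σ p) k hk'
      rw [show (finCongr (hσ p).symm ⟨k + 1, hk⟩) = ⟨k + 1, hk'⟩ from Fin.ext rfl, h1,
        Finset.sum_eq_single ⟨k, by lia⟩]
      -- The entry √(j (m - j)) at column j = k + 1, with m = N + 1, is the string coefficient √((k
      -- + 1)(N - k)).
      · have h2 : ((sortedParts π).get p : ℝ) - ((k + 1 : ℕ) : ℝ) = (N (σ p) : ℝ) - k := by
          rw [hm]; push_cast; ring
        simp only [irrepE, of_apply, if_true]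
        rw [h2]
        rw [PiLp.smul_apply, smul_eq_mul]
        push_cast
        exact mul_comm _ _
      · intro l _ hl
        have : ¬ (k + 1 = (l : ℕ) + 1) := fun h => hl (Fin.ext (by simp only; lia))
        rw [irrepE, of_apply, if_neg this, mul_zero]
      · simp

/-- E determines E* and H = [E, E*], so it is enough to conjugate E. -/
theorem IsUnitaryTriple.exists_conj_std {H E : Matrix (Fin n) (Fin n) ℂ}
    (t : IsUnitaryTriple H E) (hE : E ≠ 0) :
    ∃ U ∈ specialUnitaryGroup (Fin n) ℂ, ∃ π : n.Partition, ∀ a b c,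
      comb H E a b c = U * comb (stdH π) (stdE π) a b c * Uᴴ := by
  obtain ⟨U, hU, π, h⟩ := t.exists_unitary_conj_stdE hE
  have hUU : Uᴴ * U = 1 := mem_unitaryGroup_iff'.mp hU
  have hUU' : U * Uᴴ = 1 := mem_unitaryGroup_iff.mp hU
  obtain ⟨U', hU', hconj⟩ := exists_specialUnitary_conj_eq hU
  refine ⟨U', hU', π, fun a b c => ?_⟩
  have h1 : E = U * stdE π * Uᴴ := by rw [← h, Matrix.mul_assoc, hUU', Matrix.mul_one]
  have h2 : Eᴴ = U * (stdE π)ᴴ * Uᴴ := by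
    rw [h1]; simp [Matrix.mul_assoc]
  have hmul (X Y : Matrix (Fin n) (Fin n) ℂ) : (U * X * Uᴴ) * (U * Y * Uᴴ) = U * (X * Y) * Uᴴ := by
    rw [show (U * X * Uᴴ) * (U * Y * Uᴴ) = U * X * (Uᴴ * U) * (Y * Uᴴ) by
      simp only [Matrix.mul_assoc], hUU]
    simp only [Matrix.mul_one, Matrix.mul_assoc]
  have h3 : H = U * stdH π * Uᴴ := by
    rw [← t.lie_e_f, h2, h1, Ring.lie_def, hmul, hmul, ← (isUnitaryTriple_std π).lie_e_f,
      Ring.lie_def, Matrix.mul_sub, Matrix.sub_mul]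
  rw [hconj]
  simp only [comb, Matrix.mul_add, Matrix.add_mul, Matrix.mul_smul, Matrix.smul_mul]
  rw [← h1, ← h2, ← h3]

end NessSl2

namespace NessSl2

variable {n : ℕ}

/-! ### The adjoint orbit -/

theorem Ad_eq (g : SpecialLinearGroup (Fin n) ℂ) (A : Matrix (Fin n) (Fin n) ℂ) :
    Ad g A = g.1 * A * g.1.adjugate := rfl

theorem coe_mul_adjugate (g : SpecialLinearGroup (Fin n) ℂ) : g.1 * g.1.adjugate = 1 := by
  rw [mul_adjugate, g.2, one_smul]

theorem adjugate_mul_coe (g : SpecialLinearGroup (Fin n) ℂ) : g.1.adjugate * g.1 = 1 := by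
  rw [adjugate_mul, g.2, one_smul]

theorem trace_Ad (g : SpecialLinearGroup (Fin n) ℂ) (A : Matrix (Fin n) (Fin n) ℂ) :
    (Ad g A).trace = A.trace := by
  rw [Ad_eq, trace_mul_comm, ← Matrix.mul_assoc, adjugate_mul_coe, Matrix.one_mul]

theorem Ad_mul_Ad (g : SpecialLinearGroup (Fin n) ℂ) (A B : Matrix (Fin n) (Fin n) ℂ) :
    Ad g A * Ad g B = Ad g (A * B) := by
  simp only [Ad_eq]
  rw [show ∀ P Q : Matrix (Fin n) (Fin n) ℂ, P * A * Q * (P * B * Q) = P * A * (Q * P) * (B * Q) by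
    intros; simp only [Matrix.mul_assoc], adjugate_mul_coe]
  simp only [Matrix.mul_one, Matrix.mul_assoc]

theorem trace_Ad_sq (g : SpecialLinearGroup (Fin n) ℂ) (A : Matrix (Fin n) (Fin n) ℂ) :
    ((Ad g A) ^ 2).trace = (A ^ 2).trace := by
  rw [sq, sq, Ad_mul_Ad, trace_Ad]

theorem Ad_one (A : Matrix (Fin n) (Fin n) ℂ) : Ad 1 A = A := by
  rw [Ad_eq, show (1 : SpecialLinearGroup (Fin n) ℂ).1 = 1 from rfl]; simp

theorem mem_orbit_self (A : Matrix (Fin n) (Fin n) ℂ) : A ∈ orbit A := ⟨1, (Ad_one A).symm⟩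

/-! ### The derivative of `K` along the orbit -/

/-- The entrywise derivative at `0` of a curve of matrices. -/
def HasMatDeriv (F : ℝ → Matrix (Fin n) (Fin n) ℂ) (F' : Matrix (Fin n) (Fin n) ℂ) : Prop :=
  ∀ i j, HasDerivAt (fun t => F t i j) (F' i j) 0

namespace HasMatDeriv

variable {F G : ℝ → Matrix (Fin n) (Fin n) ℂ} {F' G' : Matrix (Fin n) (Fin n) ℂ}

theorem const (A : Matrix (Fin n) (Fin n) ℂ) : HasMatDeriv (fun _ => A) 0 :=
  fun _ _ => hasDerivAt_const _ _

theorem mul (hF : HasMatDeriv F F') (hG : HasMatDeriv G G') :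
    HasMatDeriv (fun t => F t * G t) (F' * G 0 + F 0 * G') := fun i j => by
  simp only [mul_apply, Matrix.add_apply, ← Finset.sum_add_distrib]
  exact HasDerivAt.fun_sum fun k _ => (hF i k).fun_mul (hG k j)

theorem sub (hF : HasMatDeriv F F') (hG : HasMatDeriv G G') :
    HasMatDeriv (fun t => F t - G t) (F' - G') := fun i j => (hF i j).fun_sub (hG i j)

theorem conjTranspose (hF : HasMatDeriv F F') : HasMatDeriv (fun t => (F t)ᴴ) F'ᴴ :=
  fun i j => (hF j i).star

theorem lie (hF : HasMatDeriv F F') (hG : HasMatDeriv G G') :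
    HasMatDeriv (fun t => ⁅F t, G t⁆) (⁅F', G 0⁆ + ⁅F 0, G'⁆) := by
  simp only [Ring.lie_def]
  convert (hF.mul hG).sub (hG.mul hF) using 1
  abel

theorem trace (hF : HasMatDeriv F F') : HasDerivAt (fun t => (F t).trace) F'.trace 0 :=
  HasDerivAt.fun_sum fun i _ => hF i i

theorem normSq (hF : HasMatDeriv F F') :
    HasDerivAt (fun t => normSq (F t)) (2 * (F' * (F 0)ᴴ).trace.re) 0 := by
  have h := (hF.mul hF.conjTranspose).trace
  have h2 : (F 0 * F'ᴴ).trace.re = (F' * (F 0)ᴴ).trace.re := by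
    have : (F 0 * F'ᴴ).trace = star (F' * (F 0)ᴴ).trace := by
      rw [← trace_conjTranspose, conjTranspose_mul, conjTranspose_conjTranspose]
    rw [this]; simp
  have h3 := (Complex.reCLM.hasFDerivAt.comp_hasDerivAt (0 : ℝ) h)
  refine h3.congr_deriv ?_
  rw [trace_add, Complex.reCLM_apply, Complex.add_re, h2, two_mul]

theorem det_differentiableAt (hF : ∀ i j, DifferentiableAt ℝ (fun t => F t i j) 0) :
    DifferentiableAt ℝ (fun t => (F t).det) 0 := by
  simp only [det_apply']
  exact DifferentiableAt.fun_sum fun σ _ =>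
    (DifferentiableAt.fun_finsetProd fun i _ => hF (σ i) i).const_mul _

/-- Inverses in SL are adjugates, whose entries are determinants, so the inverse of a differentiable
curve is differentiable. -/
theorem adjugate_differentiableAt (hF : ∀ i j, DifferentiableAt ℝ (fun t => F t i j) 0)
    (i j : Fin n) : DifferentiableAt ℝ (fun t => (F t).adjugate i j) 0 := by
  simp only [adjugate_apply]
  refine det_differentiableAt fun k l => ?_
  by_cases hk : k = j
  · subst hk; simp
  · simpa [updateRow_ne hk] using hF k l

end HasMatDeriv

theorem hasMatDeriv_Ad {g : ℝ → SpecialLinearGroup (Fin n) ℂ} (hg0 : g 0 = 1)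
    {M : Matrix (Fin n) (Fin n) ℂ} (hg : HasMatDeriv (fun t => (g t : Matrix (Fin n) (Fin n) ℂ)) M)
    (A : Matrix (Fin n) (Fin n) ℂ) : HasMatDeriv (fun t => Ad (g t) A) ⁅M, A⁆ := by
  have hd := HasMatDeriv.adjugate_differentiableAt fun i j => (hg i j).differentiableAt
  have hg0' : (g 0).1 = 1 := congrArg Subtype.val hg0
  set M' : Matrix (Fin n) (Fin n) ℂ := of fun i j => deriv (fun t => (g t).1.adjugate i j) 0
  have hinv : HasMatDeriv (fun t => (g t).1.adjugate) M' := fun i j => (hd i j).hasDerivAt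
  -- Differentiate the product of g and its adjugate, which is constantly 1.
  have hM' : M' = -M := by
    have h1 := hg.mul hinv
    simp only [coe_mul_adjugate, hg0'] at h1
    have h3 : M + M' = 0 := by
      ext i j
      have := (h1 i j).unique (HasMatDeriv.const 1 i j)
      simpa using this
    exact eq_neg_of_add_eq_zero_right h3
  have h := (hg.mul (HasMatDeriv.const A)).mul hinv
  simp only [hg0', hM'] at h
  intro i j
  refine (h i j).congr_deriv ?_
  simp [Ring.lie_def, sub_eq_add_neg]

/-- Only |A|⁴ varies, since tr(A²) is constant on the orbit. -/
theorem hasDerivAt_discr_Ad {g : ℝ → SpecialLinearGroup (Fin n) ℂ} (hg0 : g 0 = 1)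
    {M : Matrix (Fin n) (Fin n) ℂ} (hg : HasMatDeriv (fun t => (g t : Matrix (Fin n) (Fin n) ℂ)) M)
    (A : Matrix (Fin n) (Fin n) ℂ) : HasDerivAt (fun t => discr (Ad (g t) A))
      (4 * normSq A * (M * ⁅A, Aᴴ⁆).trace.re) 0 := by
  simp only [discr, trace_Ad_sq]
  refine (((hasMatDeriv_Ad hg0 hg A).normSq.fun_pow 2).sub_const
    (‖(A ^ 2).trace‖ ^ 2)).congr_deriv ?_
  rw [hg0, Ad_one, trace_lie_mul]
  push_cast
  ring

/-- The quotient rule, with invariance of the trace form moving all brackets off M. The two terms in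
the derivative of [B, B*] have equal real pairings with μ, because μ is hermitian. -/
theorem hasDerivAt_K_Ad {g : ℝ → SpecialLinearGroup (Fin n) ℂ} (hg0 : g 0 = 1)
    {M : Matrix (Fin n) (Fin n) ℂ} (hg : HasMatDeriv (fun t => (g t : Matrix (Fin n) (Fin n) ℂ)) M)
    {A : Matrix (Fin n) (Fin n) ℂ} (hA : discr A ≠ 0) :
    HasDerivAt (fun t => K (Ad (g t) A)) (4 / discr A ^ 2 * (M * critGrad A).trace.re) 0 := by
  have hB := hasMatDeriv_Ad hg0 hg A
  have hN := (hB.lie hB.conjTranspose).normSq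
  have hD := hasDerivAt_discr_Ad hg0 hg A
  have h := hN.fun_div hD (by rwa [hg0, Ad_one])
  refine h.congr_deriv ?_
  rw [hg0, Ad_one, isHermitian_lie_conjTranspose]
  have e1 : (⁅⁅M, A⁆, Aᴴ⁆ * ⁅A, Aᴴ⁆).trace = (M * ⁅A, ⁅Aᴴ, ⁅A, Aᴴ⁆⁆⁆).trace := by
    rw [trace_lie_mul, trace_lie_mul]
  have e2 : (⁅A, ⁅M, A⁆ᴴ⁆ * ⁅A, Aᴴ⁆).trace.re = (M * ⁅A, ⁅Aᴴ, ⁅A, Aᴴ⁆⁆⁆).trace.re := by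
    have : (⁅A, ⁅M, A⁆ᴴ⁆ * ⁅A, Aᴴ⁆).trace = star (⁅⁅M, A⁆, Aᴴ⁆ * ⁅A, Aᴴ⁆).trace := by
      rw [← trace_conjTranspose, conjTranspose_mul, isHermitian_lie_conjTranspose,
        conjTranspose_lie ⁅M, A⁆, conjTranspose_conjTranspose, trace_mul_comm]
    rw [this, e1]; simp
  rw [Matrix.add_mul, trace_add, Complex.add_re, e2, e1, critGrad, Matrix.mul_sub, Matrix.mul_smul,
    Matrix.mul_smul, trace_sub, trace_smul, trace_smul, smul_eq_mul, smul_eq_mul, Complex.sub_re,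
    ← Complex.ofReal_mul, Complex.re_ofReal_mul, Complex.re_ofReal_mul]
  field_simp
  ring

/-- The curve is exp(tX), built from the spectral decomposition of X; its determinant is exp(t tr X)
= 1. -/
theorem exists_curve_of_isHermitian {X : Matrix (Fin n) (Fin n) ℂ} (hX : Xᴴ = X)
    (htr : X.trace = 0) : ∃ g : ℝ → SpecialLinearGroup (Fin n) ℂ, g 0 = 1 ∧
      HasMatDeriv (fun t => (g t : Matrix (Fin n) (Fin n) ℂ)) X := by
  have hX' : X.IsHermitian := hX
  set U : Matrix (Fin n) (Fin n) ℂ := hX'.eigenvectorUnitary.1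
  have hU1 : U * star U = 1 := Unitary.coe_mul_star_self _
  set d := hX'.eigenvalues
  have hXU : X = U * diagonal (fun i => (d i : ℂ)) * star U := by
    conv_lhs => rw [hX'.spectral_theorem]
    rw [Unitary.conjStarAlgAut_apply]
    rfl
  have hd : ∑ i, (d i : ℂ) = 0 := htr ▸ hX'.trace_eq_sum_eigenvalues.symm
  have hdet : ∀ t : ℝ, (U * diagonal (fun i => Complex.exp (t * d i)) * star U).det = 1 := by
    intro t
    rw [det_mul_right_comm, hU1, Matrix.one_mul, det_diagonal, ← Complex.exp_sum, ← Finset.mul_sum,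
      hd, mul_zero, Complex.exp_zero]
  refine ⟨fun t => ⟨_, hdet t⟩, Subtype.ext ?_, ?_⟩
  · simp [hU1]
  · have hdiag : HasMatDeriv (fun t : ℝ => diagonal fun i => Complex.exp (t * d i))
        (diagonal fun i => (d i : ℂ)) := fun i j => by
      by_cases hij : i = j
      · subst hij
        simp only [diagonal_apply_eq]
        have h1 : HasDerivAt (fun t : ℝ => (t : ℂ) * d i) (d i : ℂ) 0 := by
          simpa using (Complex.ofRealCLM.hasDerivAt (x := (0 : ℝ))).mul_const (d i : ℂ)
        simpa using h1.cexp
      · simp only [diagonal_apply_ne _ hij]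
        exact hasDerivAt_const _ _
    have h := ((HasMatDeriv.const U).mul hdiag).mul (HasMatDeriv.const (star U))
    convert h using 1
    simp [hXU]

theorem isCriticalPoint_iff {A : Matrix (Fin n) (Fin n) ℂ} (hA : A.trace = 0) :
    IsCriticalPoint A ↔ 0 < discr A ∧ critGrad A = 0 := by
  constructor
  · rintro ⟨⟨-, hZ⟩, h⟩
    have hD := (notMem_Z_iff hA).mp hZ
    obtain ⟨g, hg0, hg⟩ := exists_curve_of_isHermitian (isHermitian_critGrad A) (trace_critGrad A)
    refine ⟨hD, ?_⟩
    have h1 := (hasDerivAt_K_Ad hg0 hg hD.ne').unique (h g hg0 fun i j => (hg i j).differentiableAt)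
    have h2 : (critGrad A * critGrad A).trace.re = normSq (critGrad A) := by
      rw [normSq, isHermitian_critGrad]
    rw [h2, mul_eq_zero, or_iff_right (by positivity), normSq_eq_zero] at h1
    exact h1
  · rintro ⟨hD, h⟩
    refine ⟨⟨mem_orbit_self A, (notMem_Z_iff hA).mpr hD⟩, fun g hg0 hg => ?_⟩
    have := hasDerivAt_K_Ad hg0 (M := of fun i j => deriv (fun t => (g t).1 i j) 0)
      (fun i j => (hg i j).hasDerivAt) hD.ne'
    simpa [h] using this

/-- `discr` is continuous along the curve at 0 and positive there, so the curve avoids Z for small t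
and has a local minimum of K at 0. -/
theorem AttainsMin.isCriticalPoint {A : Matrix (Fin n) (Fin n) ℂ} (hA : A.trace = 0)
    (h : AttainsMin A) : IsCriticalPoint A := by
  obtain ⟨hmem, hmin⟩ := h
  refine ⟨hmem, fun g hg0 hg => ?_⟩
  have hD := (notMem_Z_iff hA).mp hmem.2
  have hM : HasMatDeriv (fun t => (g t).1) (of fun i j => deriv (fun t => (g t).1 i j) 0) :=
    fun i j => (hg i j).hasDerivAt
  have hK := hasDerivAt_K_Ad hg0 hM hD.ne'
  have hloc : IsLocalMin (fun t => K (Ad (g t) A)) 0 := by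
    have hc := (hasDerivAt_discr_Ad hg0 hM A).continuousAt
    have hpos : ∀ᶠ t in nhds (0 : ℝ), 0 < discr (Ad (g t) A) :=
      hc.eventually_const_lt (by simpa only [hg0, Ad_one] using hD)
    filter_upwards [hpos] with t ht
    rw [hg0, Ad_one]
    exact hmin ⟨⟨g t, rfl⟩, (notMem_Z_iff (by rw [trace_Ad, hA])).mpr ht⟩
  rw [hloc.hasDerivAt_eq_zero hK] at hK
  exact hK

end NessSl2

/-! ### Orbits as conjugacy classes -/

namespace NessSl2

variable {n : ℕ}

/-- An invertible P can be scaled to determinant one without changing the conjugation, so the orbits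
are those of GL(n). -/
theorem mem_orbit_iff {A B : Matrix (Fin n) (Fin n) ℂ} :
    B ∈ orbit A ↔ ∃ P Q : Matrix (Fin n) (Fin n) ℂ, P * Q = 1 ∧ B = P * A * Q := by
  constructor
  · rintro ⟨g, rfl⟩
    exact ⟨g.1, g.1.adjugate, coe_mul_adjugate g, rfl⟩
  · rintro ⟨P, Q, hPQ, rfl⟩
    rcases Nat.eq_zero_or_pos n with rfl | hn
    · rw [Subsingleton.elim (P * A * Q) A]; exact mem_orbit_self A
    have hdet : P.det ≠ 0 := fun h0 => by
      have := congrArg det hPQ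
      simp [h0] at this
    obtain ⟨c, hc⟩ := IsAlgClosed.exists_pow_nat_eq (P.det)⁻¹ hn
    have hc0 : c ≠ 0 := by
      rintro rfl
      rw [zero_pow hn.ne'] at hc
      exact inv_ne_zero hdet hc.symm
    let g : SpecialLinearGroup (Fin n) ℂ :=
      ⟨c • P, by rw [det_smul, Fintype.card_fin, hc, inv_mul_cancel₀ hdet]⟩
    have h1 : g.1.adjugate * (c • P) = 1 := adjugate_mul_coe g
    have h2 : (c • P) * (c⁻¹ • Q) = 1 := by
      rw [Matrix.smul_mul, Matrix.mul_smul, smul_smul, mul_inv_cancel₀ hc0, one_smul, hPQ]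
    refine ⟨g, ?_⟩
    change P * A * Q = (c • P) * A * g.1.adjugate
    rw [left_inv_eq_right_inv h1 h2, Matrix.smul_mul, Matrix.smul_mul, Matrix.mul_smul, smul_smul,
      mul_inv_cancel₀ hc0, one_smul]

theorem orbit_symm {A B : Matrix (Fin n) (Fin n) ℂ} (h : B ∈ orbit A) : A ∈ orbit B := by
  obtain ⟨P, Q, hPQ, rfl⟩ := mem_orbit_iff.mp h
  have hQP : Q * P = 1 := mul_eq_one_comm.mp hPQ
  refine mem_orbit_iff.mpr ⟨Q, P, hQP, ?_⟩
  rw [show Q * (P * A * Q) * P = (Q * P) * A * (Q * P) by simp only [Matrix.mul_assoc], hQP]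
  simp

theorem orbit_trans {A B C : Matrix (Fin n) (Fin n) ℂ} (h : B ∈ orbit A) (h' : C ∈ orbit B) :
    C ∈ orbit A := by
  obtain ⟨P, Q, hPQ, rfl⟩ := mem_orbit_iff.mp h
  obtain ⟨P', Q', hPQ', rfl⟩ := mem_orbit_iff.mp h'
  refine mem_orbit_iff.mpr ⟨P' * P, Q * Q', ?_, by simp only [Matrix.mul_assoc]⟩
  rw [show P' * P * (Q * Q') = P' * (P * Q) * Q' by simp only [Matrix.mul_assoc], hPQ,
    Matrix.mul_one, hPQ']

theorem isNilpotent_of_mem_orbit {A B : Matrix (Fin n) (Fin n) ℂ} (h : B ∈ orbit A)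
    (hA : IsNilpotent A) : IsNilpotent B := by
  obtain ⟨P, Q, hPQ, rfl⟩ := mem_orbit_iff.mp h
  have hQP : Q * P = 1 := mul_eq_one_comm.mp hPQ
  obtain ⟨k, hk⟩ := hA
  have hpow : ∀ m : ℕ, (P * A * Q) ^ m = P * A ^ m * Q := fun m => by
    induction m with
    | zero => simp [hPQ]
    | succ m ih =>
      rw [pow_succ, ih, show P * A ^ m * Q * (P * A * Q) = P * A ^ m * (Q * P) * A * Q by
        simp only [Matrix.mul_assoc], hQP, Matrix.mul_one, pow_succ, Matrix.mul_assoc P]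
  exact ⟨k, by rw [hpow, hk]; simp⟩

theorem orbit_smul {A B : Matrix (Fin n) (Fin n) ℂ} (c : ℂ) (h : B ∈ orbit A) :
    c • B ∈ orbit (c • A) := by
  obtain ⟨P, Q, hPQ, rfl⟩ := mem_orbit_iff.mp h
  exact mem_orbit_iff.mpr ⟨P, Q, hPQ, by rw [Matrix.mul_smul, Matrix.smul_mul]⟩

/-! ### Unitary invariance -/

theorem conjTranspose_unitary_conj (U X : Matrix (Fin n) (Fin n) ℂ) :
    (U * X * Uᴴ)ᴴ = U * Xᴴ * Uᴴ := by simp [Matrix.mul_assoc]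

section Unitary

variable {U : Matrix (Fin n) (Fin n) ℂ} (hU : U ∈ unitaryGroup (Fin n) ℂ)
include hU

theorem unitary_conj_mem_orbit (B : Matrix (Fin n) (Fin n) ℂ) : U * B * Uᴴ ∈ orbit B :=
  mem_orbit_iff.mpr ⟨U, Uᴴ, mem_unitaryGroup_iff.mp hU, rfl⟩

theorem unitary_conj_mul (X Y : Matrix (Fin n) (Fin n) ℂ) :
    (U * X * Uᴴ) * (U * Y * Uᴴ) = U * (X * Y) * Uᴴ := by
  have hUU : Uᴴ * U = 1 := mem_unitaryGroup_iff'.mp hU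
  rw [show (U * X * Uᴴ) * (U * Y * Uᴴ) = U * X * (Uᴴ * U) * (Y * Uᴴ) by
    simp only [Matrix.mul_assoc], hUU]
  simp only [Matrix.mul_one, Matrix.mul_assoc]

theorem trace_unitary_conj (X : Matrix (Fin n) (Fin n) ℂ) : (U * X * Uᴴ).trace = X.trace := by
  have hUU : Uᴴ * U = 1 := mem_unitaryGroup_iff'.mp hU
  rw [trace_mul_comm, ← Matrix.mul_assoc, hUU, Matrix.one_mul]

theorem lie_unitary_conj (X Y : Matrix (Fin n) (Fin n) ℂ) :
    ⁅U * X * Uᴴ, U * Y * Uᴴ⁆ = U * ⁅X, Y⁆ * Uᴴ := by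
  rw [Ring.lie_def, Ring.lie_def, unitary_conj_mul hU, unitary_conj_mul hU, Matrix.mul_sub,
    Matrix.sub_mul]

theorem normSq_unitary_conj (X : Matrix (Fin n) (Fin n) ℂ) : normSq (U * X * Uᴴ) = normSq X := by
  rw [normSq, normSq, conjTranspose_unitary_conj, unitary_conj_mul hU, trace_unitary_conj hU]

theorem discr_unitary_conj (X : Matrix (Fin n) (Fin n) ℂ) : discr (U * X * Uᴴ) = discr X := by
  rw [discr, discr, sq (U * X * Uᴴ), unitary_conj_mul hU, trace_unitary_conj hU,
    normSq_unitary_conj hU, sq X]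

theorem K_unitary_conj (X : Matrix (Fin n) (Fin n) ℂ) : K (U * X * Uᴴ) = K X := by
  rw [K_eq, K_eq, discr_unitary_conj hU, conjTranspose_unitary_conj, lie_unitary_conj hU,
    normSq_unitary_conj hU]

end Unitary

theorem attainsMin_iff {A : Matrix (Fin n) (Fin n) ℂ} (hA : A.trace = 0) :
    AttainsMin A ↔ 0 < discr A ∧ ∀ C ∈ orbit A, 0 < discr C → K A ≤ K C := by
  have htr : ∀ C ∈ orbit A, C.trace = 0 := by
    rintro C ⟨g, rfl⟩; rw [trace_Ad, hA]
  constructor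
  · rintro ⟨⟨-, hZ⟩, hmin⟩
    exact ⟨(notMem_Z_iff hA).mp hZ, fun C hC hD => hmin ⟨hC, (notMem_Z_iff (htr C hC)).mpr hD⟩⟩
  · rintro ⟨hD, hmin⟩
    exact ⟨⟨mem_orbit_self A, (notMem_Z_iff hA).mpr hD⟩,
      fun C hC => hmin C hC.1 ((notMem_Z_iff (htr C hC.1)).mp hC.2)⟩

theorem attainsMin_unitary_conj {U : Matrix (Fin n) (Fin n) ℂ} (hU : U ∈ unitaryGroup (Fin n) ℂ)
    {B : Matrix (Fin n) (Fin n) ℂ} (hB : B.trace = 0) :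
    AttainsMin (U * B * Uᴴ) ↔ AttainsMin B := by
  have ho := unitary_conj_mem_orbit hU B
  rw [attainsMin_iff hB, attainsMin_iff (by rw [trace_unitary_conj hU, hB]), discr_unitary_conj hU,
    K_unitary_conj hU]
  exact and_congr_right fun _ => ⟨fun h C hC => h C (orbit_trans (orbit_symm ho) hC),
    fun h C hC => h C (orbit_trans ho hC)⟩

/-! ### Gradings by real weights -/

/-- The entries of `X` vanish wherever the difference of the weights is less than `d`. -/
def HasDeg (h : Fin n → ℝ) (d : ℝ) (X : Matrix (Fin n) (Fin n) ℂ) : Prop :=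
  ∀ i j, h i - h j < d → X i j = 0

namespace HasDeg

variable {h : Fin n → ℝ} {d d' : ℝ} {X Y : Matrix (Fin n) (Fin n) ℂ}

theorem mul (hX : HasDeg h d X) (hY : HasDeg h d' Y) : HasDeg h (d + d') (X * Y) := by
  intro i j hij
  rw [mul_apply]
  refine Finset.sum_eq_zero fun k _ => ?_
  by_cases hk : h i - h k < d
  · rw [hX i k hk, zero_mul]
  · rw [hY k j (by linarith), mul_zero]

theorem smul (c : ℂ) (hX : HasDeg h d X) : HasDeg h d (c • X) := fun i j hij => by
  rw [Matrix.smul_apply, hX i j hij, smul_zero]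

theorem trace_eq_zero (hX : HasDeg h d X) (hd : 0 < d) : X.trace = 0 :=
  Finset.sum_eq_zero fun i _ => hX i i (by linarith)

theorem pow (hX : HasDeg h d X) (k : ℕ) : HasDeg h (k * d) (X ^ k) := by
  induction k with
  | zero =>
    intro i j hij
    have : i ≠ j := by rintro rfl; simp at hij
    rw [pow_zero, Matrix.one_apply_ne this]
  | succ k ih =>
    rw [pow_succ]
    convert ih.mul hX using 1
    push_cast; ring

theorem isNilpotent (hX : HasDeg h d X) (hd : 0 < d) : IsNilpotent X := by
  obtain ⟨C, hC⟩ : ∃ C, ∀ i j, h i - h j < C := by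
    obtain ⟨C, hC⟩ := (Set.finite_range fun p : Fin n × Fin n => h p.1 - h p.2).bddAbove
    exact ⟨C + 1, fun i j => (hC ⟨(i, j), rfl⟩).trans_lt (lt_add_one C)⟩
  obtain ⟨k, hk⟩ := exists_nat_gt (C / d)
  refine ⟨k, ?_⟩
  ext i j
  exact hX.pow k i j ((hC i j).trans (by rwa [div_lt_iff₀ hd] at hk))

theorem conjTranspose (hX : HasDeg h d X) : HasDeg (fun i => -h i) d Xᴴ := fun i j hij => by
  rw [conjTranspose_apply, hX j i (by linarith), star_zero]

end HasDeg

theorem lie_diagonal_apply (h : Fin n → ℝ) (X : Matrix (Fin n) (Fin n) ℂ) (i j : Fin n) :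
    ⁅diagonal fun i => (h i : ℂ), X⁆ i j = ((h i - h j : ℝ) : ℂ) * X i j := by
  rw [Ring.lie_def, Matrix.sub_apply, diagonal_mul, mul_diagonal]; push_cast; ring

/-- The bracket with the diagonal matrix multiplies the (i, j) entry by h i - h j, which is at least
d wherever that entry may be nonzero. -/
theorem HasDeg.le_trace_lie {h : Fin n → ℝ} {d : ℝ} {X : Matrix (Fin n) (Fin n) ℂ}
    (hX : HasDeg h d X) :
    d * normSq X ≤ (⁅diagonal fun i => (h i : ℂ), X⁆ * Xᴴ).trace.re := by
  rw [normSq_eq_sum, trace, Complex.re_sum, Finset.mul_sum]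
  refine Finset.sum_le_sum fun i _ => ?_
  rw [diag_apply, mul_apply, Complex.re_sum, Finset.mul_sum]
  refine Finset.sum_le_sum fun j _ => ?_
  rw [lie_diagonal_apply, conjTranspose_apply, mul_assoc, RCLike.star_def, Complex.mul_conj,
    Complex.normSq_eq_norm_sq, ← Complex.ofReal_mul, Complex.ofReal_re]
  by_cases hij : h i - h j < d
  · rw [hX i j hij]; simp
  · exact mul_le_mul_of_nonneg_right (not_lt.mp hij) (sq_nonneg _)

/-- `g = U T` with `U` unitary and `T` triangular for the flag given by the weights `h`. -/
theorem exists_unitary_mul_hasDeg_zero {P Q : Matrix (Fin n) (Fin n) ℂ} (hPQ : P * Q = 1)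
    (h : Fin n → ℝ) : ∃ U ∈ unitaryGroup (Fin n) ℂ, ∃ T S : Matrix (Fin n) (Fin n) ℂ,
      T * S = 1 ∧ HasDeg h 0 T ∧ HasDeg h 0 S ∧ P = U * T ∧ Q = S * Uᴴ := by
  -- Gram-Schmidt runs through the columns of P in order of decreasing weight; this makes U* P
  -- triangular for the flag.
  let σ := Tuple.sort fun i => -h i
  have hσ : Monotone ((fun i => -h i) ∘ σ) := Tuple.monotone_sort _
  let f : Fin n → EuclideanSpace ℂ (Fin n) := fun j => WithLp.toLp 2 fun a => P a (σ j)
  let b := InnerProductSpace.gramSchmidtOrthonormalBasis (𝕜 := ℂ) (by simp) f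
  let b' := b.reindex σ
  let U : Matrix (Fin n) (Fin n) ℂ := of fun a j => b' j a
  have hU : U ∈ unitaryGroup (Fin n) ℂ := by
    have := (EuclideanSpace.basisFun (Fin n) ℂ).toMatrix_orthonormalBasis_mem_unitary b'
    convert this using 1
    ext a j
    simp [U, Module.Basis.toMatrix_apply]
  have hUU : Uᴴ * U = 1 := mem_unitaryGroup_iff'.mp hU
  have hUU' : U * Uᴴ = 1 := mem_unitaryGroup_iff.mp hU
  have hT : HasDeg h 0 (Uᴴ * P) := by
    intro i j hij
    have h1 : (Uᴴ * P) i j = inner ℂ (b (σ.symm i)) (f (σ.symm j)) := by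
      simp [mul_apply, U, b', f, PiLp.inner_apply, mul_comm]
    rw [h1]
    refine InnerProductSpace.gramSchmidtOrthonormalBasis_inv_triangular _ _ ?_
    by_contra! hle
    have := hσ hle
    simp only [Function.comp_apply, Equiv.apply_symm_apply] at this
    linarith
  have hTS : (Uᴴ * P) * (Q * U) = 1 := by
    rw [show (Uᴴ * P) * (Q * U) = Uᴴ * (P * Q) * U by simp only [Matrix.mul_assoc], hPQ,
      Matrix.mul_one, hUU]
  refine ⟨U, hU, Uᴴ * P, Q * U, hTS, hT, ?_, ?_, ?_⟩
  -- The inverse of a block triangular matrix is block triangular.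
  · have hbt : BlockTriangular (Uᴴ * P) fun i => -h i := fun i j hij => hT i j (by linarith)
    let _ := invertibleOfRightInverse _ _ hTS
    have hinv := blockTriangular_inv_of_blockTriangular hbt
    rw [inv_eq_right_inv hTS] at hinv
    exact fun i j hij => hinv (by linarith : -h j < -h i)
  · rw [← Matrix.mul_assoc, hUU', Matrix.one_mul]
  · rw [Matrix.mul_assoc, hUU', Matrix.mul_one]

end NessSl2

namespace NessSl2

variable {n : ℕ}

/-! ### Lower bounds for triangular matrices -/

/-- Cauchy-Schwarz for [B, B*] and D: their inner product equals Re tr([D, B] B*), which is at least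
2 |B|². -/
theorem HasDeg.normSq_lie_ge {h : Fin n → ℝ} {B : Matrix (Fin n) (Fin n) ℂ} (hB : HasDeg h 2 B) :
    4 * normSq B ^ 2 ≤ normSq (diagonal fun i => (h i : ℂ)) * normSq ⁅B, Bᴴ⁆ := by
  set D : Matrix (Fin n) (Fin n) ℂ := diagonal fun i => (h i : ℂ) with hD
  have hDs : Dᴴ = D := by rw [hD, diagonal_conjTranspose]; congr 1; ext i; simp
  set q := (⁅D, B⁆ * Bᴴ).trace.re with hq
  have hq2 : 2 * normSq B ≤ q := hB.le_trace_lie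
  have hqD : (⁅B, Bᴴ⁆ * D).trace.re = q := by
    rw [trace_mul_comm, ← trace_lie_mul]
  rcases eq_or_ne (normSq D) 0 with h0 | h0
  · have : q = 0 := by rw [hq, normSq_eq_zero.mp h0]; simp
    have := normSq_nonneg B
    rw [h0, zero_mul, (by linarith : normSq B = 0)]; simp
  have hS : 0 < normSq D := lt_of_le_of_ne (normSq_nonneg D) (Ne.symm h0)
  -- The component of [B, B*] orthogonal to D.
  have h1 := normSq_nonneg (⁅B, Bᴴ⁆ + ((-(q / normSq D) : ℝ) : ℂ) • D)
  rw [normSq_add, normSq_smul, conjTranspose_smul, hDs, Matrix.mul_smul, trace_smul, smul_eq_mul,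
    RCLike.star_def, Complex.conj_ofReal, Complex.re_ofReal_mul, hqD, Complex.norm_real,
    Real.norm_eq_abs, sq_abs] at h1
  have h2 : normSq D * (normSq ⁅B, Bᴴ⁆ + (-(q / normSq D)) ^ 2 * normSq D +
      2 * (-(q / normSq D) * q)) = normSq D * normSq ⁅B, Bᴴ⁆ - q ^ 2 := by field_simp; ring
  have h3 := mul_nonneg hS.le h1
  rw [h2] at h3
  have := normSq_nonneg B
  nlinarith

section Triangular

variable {h : Fin n → ℝ} {d : ℝ} {N : Matrix (Fin n) (Fin n) ℂ}

theorem HasDeg.trace_diagonal_mul (hN : HasDeg h d N) (hd : 0 < d) (v : Fin n → ℂ) :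
    (diagonal v * N).trace = 0 :=
  Finset.sum_eq_zero fun i _ => by
    rw [diag_apply, diagonal_mul, hN i i (by linarith), mul_zero]

theorem HasDeg.trace_sq_eq_zero (hN : HasDeg h d N) (hd : 0 < d) : (N * N).trace = 0 :=
  (hN.mul hN).trace_eq_zero (by linarith)

theorem HasDeg.normSq_diagonal_add (hN : HasDeg h d N) (hd : 0 < d) :
    normSq (diagonal (fun i => (h i : ℂ)) + N) =
      normSq (diagonal fun i => (h i : ℂ)) + normSq N := by
  have h1 : (diagonal (fun i => (h i : ℂ)) * Nᴴ).trace = 0 := by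
    have := hN.trace_diagonal_mul hd fun i => star (h i : ℂ)
    have h2 := congrArg star this
    rw [← trace_conjTranspose, conjTranspose_mul, star_zero, trace_mul_comm,
      diagonal_conjTranspose] at h2
    have hst : star (fun i => star (h i : ℂ)) = fun i => (h i : ℂ) := by ext i; simp
    rwa [hst] at h2
  rw [normSq_add, h1]; simp

theorem HasDeg.discr_diagonal_add (hN : HasDeg h d N) (hd : 0 < d) :
    discr (diagonal (fun i => (h i : ℂ)) + N) =
      normSq N * (2 * normSq (diagonal fun i => (h i : ℂ)) + normSq N) := by
  set D : Matrix (Fin n) (Fin n) ℂ := diagonal fun i => (h i : ℂ) with hD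
  have hDs : Dᴴ = D := by rw [hD, diagonal_conjTranspose]; congr 1; ext i; simp
  have hDD : (D * D).trace = normSq D := by rw [ofReal_normSq, hDs]
  have hDN : (D * N).trace = 0 := hN.trace_diagonal_mul hd _
  have hsq : ((D + N) ^ 2).trace = normSq D := by
    rw [sq, Matrix.add_mul, Matrix.mul_add, Matrix.mul_add, trace_add, trace_add, trace_add,
      trace_mul_comm N D, hDN, hN.trace_sq_eq_zero hd, hDD]
    ring
  rw [discr, hN.normSq_diagonal_add hd, hsq, Complex.norm_real, Real.norm_eq_abs, sq_abs]
  ring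

/-- Bessel's inequality for μ and the orthogonal directions D and N + N*. The inner products are q
and -2q with q ≥ 2 |N|², so |D|² |μ|² ≥ q² + 2 |D|² q² / |N|² ≥ 4 |N|⁴ + 8 |D|² |N|², and this is 4
`discr (D + N)`. -/
theorem HasDeg.normSq_lie_diagonal_add_ge (hN : HasDeg h 2 N) :
    4 * discr (diagonal (fun i => (h i : ℂ)) + N) ≤ normSq (diagonal fun i => (h i : ℂ)) *
      normSq ⁅diagonal (fun i => (h i : ℂ)) + N, (diagonal (fun i => (h i : ℂ)) + N)ᴴ⁆ := by
  rw [hN.discr_diagonal_add two_pos]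
  set D : Matrix (Fin n) (Fin n) ℂ := diagonal fun i => (h i : ℂ) with hD
  have hDs : Dᴴ = D := by rw [hD, diagonal_conjTranspose]; congr 1; ext i; simp
  set μ := ⁅D + N, (D + N)ᴴ⁆ with hμ
  have hμs : μᴴ = μ := isHermitian_lie_conjTranspose _
  set q := (⁅D, N⁆ * Nᴴ).trace.re with hq
  have hq2 : 2 * normSq N ≤ q := hN.le_trace_lie
  have hN0 := normSq_nonneg N
  rcases eq_or_ne (normSq D) 0 with h0 | h0
  · have : q = 0 := by rw [hq, normSq_eq_zero.mp h0]; simp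
    rw [(by linarith : normSq N = 0), h0]; simp
  rcases eq_or_ne (normSq N) 0 with h0' | h0'
  · rw [h0']
    have := mul_nonneg (normSq_nonneg D) (normSq_nonneg μ)
    linarith
  have hS : 0 < normSq D := lt_of_le_of_ne (normSq_nonneg D) (Ne.symm h0)
  have hν : 0 < normSq N := lt_of_le_of_ne (normSq_nonneg N) (Ne.symm h0')
  have hμD : (μ * D).trace.re = q := by
    have e1 : (⁅D, N⁆ * D).trace = 0 := by
      rw [← lie_skew, Matrix.neg_mul, trace_neg, trace_lie_mul, lie_self, Matrix.mul_zero,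
        trace_zero, neg_zero]
    rw [trace_mul_comm, hμ, ← trace_lie_mul, lie_add, lie_self, zero_add, conjTranspose_add, hDs,
      Matrix.mul_add, trace_add, e1, zero_add]
  -- Since tr([A, A*] A) = 0 for A = D + N, the pairings of μ with D and with N are opposite.
  have hμN : (μ * N).trace.re = -q := by
    have e1 : (μ * (D + N)).trace = 0 := by
      rw [hμ, ← lie_skew, Matrix.neg_mul, trace_neg, trace_lie_mul, lie_self, Matrix.mul_zero,
        trace_zero, neg_zero]
    rw [Matrix.mul_add, trace_add] at e1
    have := congrArg Complex.re e1
    rw [Complex.add_re, hμD, Complex.zero_re] at this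
    linarith
  have hμN' : (μ * Nᴴ).trace.re = -q := by
    have : (μ * Nᴴ).trace = star (μ * N).trace := by
      rw [← trace_conjTranspose, conjTranspose_mul, hμs, trace_mul_comm]
    rw [this, ← hμN]; simp
  have hNN : normSq (N + Nᴴ) = 2 * normSq N := by
    have : normSq Nᴴ = normSq N := by
      rw [normSq, normSq, conjTranspose_conjTranspose, trace_mul_comm]
    rw [normSq_add, this, conjTranspose_conjTranspose, hN.trace_sq_eq_zero two_pos, Complex.zero_re]
    ring
  have hDN : (D * (N + Nᴴ)).trace.re = 0 := by
    have e1 : (D * N).trace = 0 := hN.trace_diagonal_mul two_pos _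
    have e2 : (D * Nᴴ).trace = star (D * N).trace := by
      rw [← trace_conjTranspose, conjTranspose_mul, hDs, trace_mul_comm]
    rw [Matrix.mul_add, trace_add, e2, e1]; simp
  -- Subtract from μ its projections on D and on N + N*.
  have h1 := normSq_nonneg (μ + (((-(q / normSq D) : ℝ) : ℂ) • D +
    ((q / normSq N : ℝ) : ℂ) • (N + Nᴴ)))
  rw [normSq_add, normSq_add, normSq_smul, normSq_smul, hNN] at h1
  simp only [conjTranspose_add, conjTranspose_smul, conjTranspose_conjTranspose, hDs,
    Matrix.mul_add, Matrix.smul_mul, Matrix.mul_smul, trace_add, trace_smul, smul_eq_mul,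
    RCLike.star_def, Complex.conj_ofReal, Complex.re_ofReal_mul, Complex.add_re, hμD, hμN, hμN',
    Complex.norm_real, Real.norm_eq_abs, sq_abs] at h1 hDN
  have h2 : normSq D * (normSq μ + ((-(q / normSq D)) ^ 2 * normSq D + (q / normSq N) ^ 2 *
      (2 * normSq N) + 2 * 0) + 2 * (-(q / normSq D) * q + q / normSq N * (-q + -q))) =
      normSq D * normSq μ - q ^ 2 - 2 * normSq D * (q ^ 2 / normSq N) := by field_simp; ring
  have h4 : 0 ≤ normSq D * normSq μ - q ^ 2 - 2 * normSq D * (q ^ 2 / normSq N) := by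
    rw [← h2]
    refine mul_nonneg hS.le ?_
    have e : (D * Nᴴ).trace.re = -(D * N).trace.re := by linarith
    rw [e] at h1
    exact h1.trans_eq (by ring)
  have h5 : 4 * normSq N ≤ q ^ 2 / normSq N := by
    rw [le_div_iff₀ hν]; nlinarith
  have h6 : (2 * normSq N) ^ 2 ≤ q ^ 2 := by gcongr
  have h7 := mul_le_mul_of_nonneg_left h5 hS.le
  nlinarith

end Triangular

/-! ### Conjugation by exponentials of nilpotent elements -/

/-- This is exp(a) y exp(-a) = exp(ad a) y when the series on the right stops after the quadratic
term. It is proved by commuting y past the divided powers of a. -/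
theorem exp_mul_of_lie_eq_zero {R : Type*} [Ring R] [Algebra ℚ R] {a y : R} (ha : IsNilpotent a)
    (h : ⁅a, ⁅a, ⁅a, y⁆⁆⁆ = 0) :
    IsNilpotent.exp a * y = (y + ⁅a, y⁆ + (1 / 2 : ℚ) • ⁅a, ⁅a, y⁆⁆) * IsNilpotent.exp a := by
  set z := ⁅a, y⁆ with hz
  set w := ⁅a, z⁆ with hw
  have h1 : a * y = y * a + z := by rw [hz, Ring.lie_def]; abel
  have h2 : a * z = z * a + w := by rw [hw, Ring.lie_def]; abel
  have h3 : a * w = w * a := by rwa [Ring.lie_def, sub_eq_zero] at h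
  let d : ℕ → R := fun i => ((i.factorial : ℚ)⁻¹) • a ^ i
  have hd0 : d 0 = 1 := by simp [d]
  have hd1 : d 1 = a := by simp [d]
  have hd : ∀ i, a * d i = ((i : ℚ) + 1) • d (i + 1) := fun i => by
    simp only [d, mul_smul_comm, smul_smul, ← pow_succ']
    congr 1
    rw [Nat.factorial_succ]
    push_cast
    have : (i.factorial : ℚ) ≠ 0 := by exact_mod_cast i.factorial_ne_zero
    field_simp
  obtain ⟨k, hk⟩ := ha
  -- The extra terms vanish; they allow the three shifted sums to be taken over one common range.
  have hs : ∀ m, IsNilpotent.exp a = ∑ i ∈ Finset.range (k + m), d i := fun m =>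
    IsNilpotent.exp_eq_sum (pow_eq_zero_of_le (by lia) hk)
  have e2 : d 2 = (1 / 2 : ℚ) • (a * a) := by simp [d, sq]
  clear_value d
  have key : ∀ i, d (i + 2) * y = y * d (i + 2) + z * d (i + 1) + (1 / 2 : ℚ) • (w * d i) := by
    intro i
    induction i with
    | zero =>
      rw [e2, hd1, hd0, smul_mul_assoc, mul_assoc, h1, mul_add, ← mul_assoc, h1, h2, mul_smul_comm]
      simp only [add_mul, mul_one, mul_assoc]
      module
    | succ i ih =>
      have hi : ((i : ℚ) + 3) ≠ 0 := by positivity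
      have e3 : ((i : ℚ) + 3) • d (i + 1 + 2) = a * d (i + 2) := by
        rw [hd]; congr 1; push_cast; ring
      have e4 : a * d (i + 1) = ((i : ℚ) + 2) • d (i + 2) := by
        rw [hd]; congr 1; push_cast; ring
      have : ((i : ℚ) + 3) • (d (i + 1 + 2) * y) = ((i : ℚ) + 3) •
          (y * d (i + 1 + 2) + z * d (i + 1 + 1) + (1 / 2 : ℚ) • (w * d (i + 1))) := by
        rw [← smul_mul_assoc, e3, mul_assoc, ih, mul_add, mul_add, mul_smul_comm, ← mul_assoc,
          ← mul_assoc, ← mul_assoc, h1, h2, h3, add_mul, add_mul, mul_assoc, mul_assoc z,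
          mul_assoc w, e4, hd i, ← e3]
        simp only [mul_smul_comm]
        module
      exact smul_right_injective R hi this
  have hs0 := hs 0
  have hs1 := hs 1
  have hs2 := hs 2
  rw [add_zero] at hs0
  rw [Finset.sum_range_succ', hd0] at hs1
  rw [Finset.sum_range_succ', Finset.sum_range_succ', hd0, hd1] at hs2
  have hL : IsNilpotent.exp a * y = (∑ i ∈ Finset.range k, d (i + 2) * y) + a * y + y := by
    rw [hs2, add_mul, add_mul, one_mul, Finset.sum_mul]
  have e1 : y * IsNilpotent.exp a = (∑ i ∈ Finset.range k, y * d (i + 2)) + y * a + y := by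
    rw [hs2, mul_add, mul_add, mul_one, Finset.mul_sum]
  have e2 : z * IsNilpotent.exp a = (∑ i ∈ Finset.range k, z * d (i + 1)) + z := by
    rw [hs1, mul_add, mul_one, Finset.mul_sum]
  have e3 : w * IsNilpotent.exp a = ∑ i ∈ Finset.range k, w * d i := by
    rw [hs0, Finset.mul_sum]
  rw [hL, add_mul, add_mul, smul_mul_assoc, e1, e2, e3, Finset.sum_congr rfl fun i _ => key i,
    Finset.sum_add_distrib, Finset.sum_add_distrib, ← Finset.smul_sum, h1]
  abel

namespace IsUnitaryTriple

variable {H E : Matrix (Fin n) (Fin n) ℂ}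

/-- Conjugation by exp(sE); the cube of ad E vanishes on the span. -/
theorem comb_mem_orbit (t : IsUnitaryTriple H E) (hE : IsNilpotent E) (a b c s : ℂ) :
    comb H E (a + s * c) (b - 2 * s * a - s ^ 2 * c) c ∈ orbit (comb H E a b c) := by
  have hsE : s • E = comb H E 0 s 0 := by simp [comb]
  have hnil : IsNilpotent (s • E) := hE.smul s
  have h1 : ⁅s • E, comb H E a b c⁆ = comb H E (s * c) (-(2 * s * a)) 0 := by
    rw [hsE, t.lie_comb]; congr 1 <;> ring
  have h2 : ⁅s • E, ⁅s • E, comb H E a b c⁆⁆ = comb H E 0 (-(2 * s ^ 2 * c)) 0 := by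
    rw [h1, hsE, t.lie_comb]; congr 1 <;> ring
  have h3 : ⁅s • E, ⁅s • E, ⁅s • E, comb H E a b c⁆⁆⁆ = 0 := by
    rw [h2, hsE, t.lie_comb]; simp [comb]
  have h := exp_mul_of_lie_eq_zero hnil h3
  have h4 : comb H E a b c + ⁅s • E, comb H E a b c⁆ +
      (1 / 2 : ℚ) • ⁅s • E, ⁅s • E, comb H E a b c⁆⁆ =
      comb H E (a + s * c) (b - 2 * s * a - s ^ 2 * c) c := by
    have hq (X : Matrix (Fin n) (Fin n) ℂ) : (1 / 2 : ℚ) • X = (1 / 2 : ℂ) • X := by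
      ext i j
      simp only [Matrix.smul_apply, Rat.smul_def, smul_eq_mul]
      push_cast; rfl
    rw [hq, h2, h1]
    simp only [comb]
    module
  rw [h4] at h
  refine mem_orbit_iff.mpr ⟨IsNilpotent.exp (s • E), IsNilpotent.exp (-(s • E)),
    IsNilpotent.exp_mul_exp_neg_self hnil, ?_⟩
  rw [h, Matrix.mul_assoc, IsNilpotent.exp_mul_exp_neg_self hnil, Matrix.mul_one]

theorem symm (t : IsUnitaryTriple H E) : IsUnitaryTriple (-H) Eᴴ where
  isHermitian := by rw [conjTranspose_neg, t.isHermitian]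
  lie_h_e := by rw [neg_lie, t.lie_h_f, neg_smul, neg_neg]
  lie_e_f := by rw [conjTranspose_conjTranspose, ← lie_skew, t.lie_e_f]

theorem comb_symm (H E : Matrix (Fin n) (Fin n) ℂ) (a b c : ℂ) :
    comb (-H) Eᴴ a b c = comb H E (-a) c b := by
  simp only [comb, conjTranspose_conjTranspose]; module

/-- Every element of the span is conjugate to a multiple of `H`, `E` or `E*`. -/
theorem exists_mem_orbit (t : IsUnitaryTriple H E) (hE : IsNilpotent E) (a b c : ℂ) :
    (∃ r : ℂ, r ≠ 0 ∧ r • H ∈ orbit (comb H E a b c)) ∨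
      (∃ r : ℂ, r • E ∈ orbit (comb H E a b c)) ∨ ∃ r : ℂ, r • Eᴴ ∈ orbit (comb H E a b c) := by
  have hF : IsNilpotent Eᴴ := by
    obtain ⟨k, hk⟩ := hE
    exact ⟨k, by rw [← conjTranspose_pow, hk, conjTranspose_zero]⟩
  by_cases hc : c = 0
  · subst hc
    by_cases ha : a = 0
    · subst ha
      refine Or.inr (Or.inl ⟨b, ?_⟩)
      convert mem_orbit_self _ using 1
      simp [comb]
    · refine Or.inl ⟨a, ha, ?_⟩
      convert t.comb_mem_orbit hE a b 0 (b / (2 * a)) using 1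
      have : b - 2 * (b / (2 * a)) * a - (b / (2 * a)) ^ 2 * 0 = 0 := by field_simp; ring
      rw [this]; simp [comb]
  -- Choosing s with a + s c = r, where r² = a² + bc, makes the coefficient of E vanish.
  · obtain ⟨r, hr⟩ := IsAlgClosed.exists_pow_nat_eq (a ^ 2 + b * c) two_pos
    have h1 := t.comb_mem_orbit hE a b c ((r - a) / c)
    have e1 : a + (r - a) / c * c = r := by field_simp; ring
    have e2 : b - 2 * ((r - a) / c) * a - ((r - a) / c) ^ 2 * c = 0 := by
      field_simp; linear_combination -hr
    rw [e1, e2] at h1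
    by_cases hr0 : r = 0
    · refine Or.inr (Or.inr ⟨c, ?_⟩)
      convert h1 using 1
      simp [comb, hr0]
    · refine Or.inl ⟨r, hr0, orbit_trans h1 ?_⟩
      -- The exponential of a multiple of E* removes the remaining coefficient of E*.
      have h2 := t.symm.comb_mem_orbit hF (-r) c 0 (c / (2 * -r))
      rw [comb_symm, comb_symm] at h2
      have e3 : c - 2 * (c / (2 * -r)) * -r - (c / (2 * -r)) ^ 2 * 0 = 0 := by field_simp; ring
      rw [e3, neg_neg] at h2
      convert h2 using 1
      simp [comb]

end IsUnitaryTriple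

end NessSl2

/-! ### Critical points, and minima on standard subalgebras -/

namespace NessSl2

variable {n : ℕ}

namespace IsUnitaryTriple

variable {H E : Matrix (Fin n) (Fin n) ℂ}

theorem trace_comb (t : IsUnitaryTriple H E) (a b c : ℂ) : (comb H E a b c).trace = 0 := by
  have h1 : H.trace = 0 := by rw [← t.lie_e_f, NessSl2.trace_lie]
  have h2 : E.trace = 0 := by
    have := NessSl2.trace_lie H E
    rw [t.lie_h_e, trace_smul] at this
    simpa using this
  simp [comb, h1, h2]

theorem unitary_conj (t : IsUnitaryTriple H E) {U : Matrix (Fin n) (Fin n) ℂ}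
    (hU : U ∈ unitaryGroup (Fin n) ℂ) : IsUnitaryTriple (U * H * Uᴴ) (U * E * Uᴴ) where
  isHermitian := by rw [conjTranspose_unitary_conj, t.isHermitian]
  lie_h_e := by rw [lie_unitary_conj hU, t.lie_h_e, Matrix.mul_smul, Matrix.smul_mul]
  lie_e_f := by rw [conjTranspose_unitary_conj, lie_unitary_conj hU, t.lie_e_f]

theorem comb_unitary_conj (H E U : Matrix (Fin n) (Fin n) ℂ) (a b c : ℂ) :
    comb (U * H * Uᴴ) (U * E * Uᴴ) a b c = U * comb H E a b c * Uᴴ := by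
  simp only [comb, conjTranspose_unitary_conj, Matrix.mul_add, Matrix.add_mul, Matrix.mul_smul,
    Matrix.smul_mul]

theorem normSq_pos_of_discr_pos (t : IsUnitaryTriple H E) {a b c : ℂ}
    (hD : 0 < discr (comb H E a b c)) : 0 < normSq H := by
  refine lt_of_le_of_ne (normSq_nonneg H) fun h0 => ?_
  have := t.normSq_lie_comb a b c
  rw [← h0, zero_mul] at this
  linarith

theorem critGrad_comb (t : IsUnitaryTriple H E) {a b c : ℂ} (hD : 0 < discr (comb H E a b c)) :
    critGrad (comb H E a b c) = 0 := by
  have hS : (normSq H : ℂ) ≠ 0 := by exact_mod_cast (t.normSq_pos_of_discr_pos hD).ne'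
  have h1 := t.lie_lie_comb a b c _ rfl
  have h2 : (normSq H : ℂ) * normSq ⁅comb H E a b c, (comb H E a b c)ᴴ⁆ =
      4 * discr (comb H E a b c) := by exact_mod_cast t.normSq_lie_comb a b c
  set A := comb H E a b c
  have h3 : (normSq H : ℂ) • critGrad A = 0 := by
    rw [critGrad, smul_sub, smul_comm, h1, smul_smul, smul_smul, sub_eq_zero]
    congr 1; linear_combination -(normSq A : ℂ) * h2
  exact (smul_eq_zero.mp h3).resolve_left hS

end IsUnitaryTriple

/-! ### Critical points and standard subalgebras -/

theorem IsCriticalPoint.isSUConjToStd {A : Matrix (Fin n) (Fin n) ℂ} (hA : A.trace = 0)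
    (hW : ¬ ∃ B ∈ W n \ Z n, B ∈ orbit A) (h : IsCriticalPoint A) :
    Module.finrank ℂ (genAlg A) = 3 ∧ IsSUConjToStd (genAlg A) := by
  -- Otherwise A itself would be an element of W \ Z in its orbit.
  have hμ : ⁅A, Aᴴ⁆ ≠ 0 := fun h0 => hW ⟨A, ⟨⟨hA, h0⟩, h.1.2⟩, mem_orbit_self A⟩
  obtain ⟨hD, hc⟩ := (isCriticalPoint_iff hA).mp h
  obtain ⟨H, E, t, hE, hgen⟩ := exists_isUnitaryTriple_of_critGrad_eq_zero hD hμ hc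
  rw [hgen]
  refine ⟨t.finrank_toLieSubalgebra hE, ?_⟩
  obtain ⟨U, hU, π, hconj⟩ := t.exists_conj_std hE
  refine ⟨U, hU, π, ?_⟩
  ext B
  constructor
  · rintro ⟨a, b, c, rfl⟩
    exact ⟨_, (mem_stdSl2_iff π).mpr ⟨a, b, c, rfl⟩, (hconj a b c).symm⟩
  · rintro ⟨_, hB, rfl⟩
    obtain ⟨a, b, c, rfl⟩ := (mem_stdSl2_iff π).mp hB
    exact ⟨a, b, c, (hconj a b c).symm⟩

theorem exists_conj_of_isSUConjToStd {A : Matrix (Fin n) (Fin n) ℂ}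
    (h : IsSUConjToStd (genAlg A)) : ∃ π : n.Partition, SUConjInto A (stdSl2 π) := by
  obtain ⟨U, hU, π, hπ⟩ := h
  have hmem : A ∈ (genAlg A : Set (Matrix (Fin n) (Fin n) ℂ)) :=
    LieSubalgebra.subset_lieSpan (by simp)
  rw [hπ] at hmem
  obtain ⟨B, hB, rfl⟩ := hmem
  exact ⟨π, U, hU, B, hB, rfl⟩

theorem finrank_genAlg_le_one {A : Matrix (Fin n) (Fin n) ℂ} {s : ℂ} (h : A = s • Aᴴ) :
    Module.finrank ℂ (genAlg A) ≤ 1 := by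
  let L : LieSubalgebra ℂ (Matrix (Fin n) (Fin n) ℂ) :=
    { Submodule.span ℂ {Aᴴ} with
      lie_mem' := by
        intro x y hx hy
        obtain ⟨a, rfl⟩ := Submodule.mem_span_singleton.mp hx
        obtain ⟨b, rfl⟩ := Submodule.mem_span_singleton.mp hy
        rw [smul_lie, lie_smul, lie_self, smul_zero, smul_zero]
        exact Submodule.zero_mem _ }
  have h1 : Aᴴ ∈ L := Submodule.mem_span_singleton_self _
  have h2 : A ∈ L := by
    have := L.smul_mem s h1
    rwa [← h] at this
  have hle : genAlg A ≤ L := by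
    rw [genAlg, LieSubalgebra.lieSpan_le]
    rintro X (rfl | rfl | rfl)
    · exact h2
    · exact h1
    · exact L.lie_mem h2 h1
  have h3 : (genAlg A).toSubmodule ≤ Submodule.span ℂ {Aᴴ} := fun X hX => hle hX
  calc Module.finrank ℂ (genAlg A) ≤ Module.finrank ℂ (Submodule.span ℂ {Aᴴ}) :=
        Submodule.finrank_mono h3
    _ ≤ 1 := (finrank_span_le_card _).trans (by simp)

/-- On Z the Cauchy-Schwarz inequality is an equality, so A is a multiple of A* and generates at
most a line. -/
theorem discr_pos_of_finrank_genAlg {A : Matrix (Fin n) (Fin n) ℂ} (hA : A ≠ 0)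
    (h : Module.finrank ℂ (genAlg A) = 3) : 0 < discr A := by
  refine lt_of_le_of_ne (discr_nonneg A) fun h0 => ?_
  have h1 := normSq_sub_proj A hA
  rw [← h0, mul_eq_zero, or_iff_right (normSq_pos.mpr hA).ne', normSq_eq_zero, sub_eq_zero] at h1
  have := finrank_genAlg_le_one h1
  lia

/-! ### Minima on the orbits of the elements of the standard subalgebras -/

section Standard

variable (π : n.Partition)

theorem hasDeg_stdE : HasDeg (weight π) 2 (stdE π) := by
  intro i j hij
  have h := congrFun (congrFun (isUnitaryTriple_std π).lie_h_e i) j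
  rw [stdH, lie_diagonal_apply, Matrix.smul_apply, smul_eq_mul] at h
  have h1 : ((weight π i - weight π j : ℝ) : ℂ) - 2 ≠ 0 := by
    rw [show ((weight π i - weight π j : ℝ) : ℂ) - 2 = ((weight π i - weight π j - 2 : ℝ) : ℂ) by
      push_cast; ring]
    exact_mod_cast (by linarith : weight π i - weight π j - 2 < 0).ne
  have h2 : (((weight π i - weight π j : ℝ) : ℂ) - 2) * stdE π i j = 0 := by
    rw [sub_mul, h, sub_self]
  exact (mul_eq_zero.mp h2).resolve_left h1

theorem exists_weight_eq (i : Fin n) : ∃ m ∈ π.parts, ∃ k : ℕ, weight π i = (m : ℝ) - 1 - 2 * k := by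
  refine ⟨(sortedParts π).get ((blockEquiv π).symm i).1, ?_, ((blockEquiv π).symm i).2, rfl⟩
  exact (Multiset.mem_sort _).mp (List.get_mem (sortedParts π) ((blockEquiv π).symm i).1)

theorem exists_index_of_weight {m k : ℕ} (hm : m ∈ π.parts) (hk : k < m) :
    ∃ i, weight π i = (m : ℝ) - 1 - 2 * k := by
  have : m ∈ sortedParts π := by rwa [sortedParts, Multiset.mem_sort]
  obtain ⟨p, rfl⟩ := List.get_of_mem this
  exact ⟨blockEquiv π ⟨p, ⟨k, hk⟩⟩, by rw [weight, Equiv.symm_apply_apply]⟩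

variable {π}

/-- The weights of a block of size m have the parity of m - 1, so for an even type all differences
are even integers. -/
theorem IsEvenType.two_le_weight_sub (hπ : IsEvenType π) {i j : Fin n}
    (hij : 0 < weight π i - weight π j) : 2 ≤ weight π i - weight π j := by
  obtain ⟨a, ha, k, hk⟩ := exists_weight_eq π i
  obtain ⟨b, hb, l, hl⟩ := exists_weight_eq π j
  obtain ⟨c, hc⟩ : ∃ c : ℤ, (a : ℤ) - b = 2 * c := by
    have : Even ((a : ℤ) - b) := by
      rw [Int.even_sub, Int.even_coe_nat, Int.even_coe_nat]; exact hπ a ha b hb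
    obtain ⟨c, hc⟩ := this
    exact ⟨c, by rw [hc]; ring⟩
  have hc' : (a : ℝ) - b = 2 * c := by exact_mod_cast hc
  have hz : weight π i - weight π j = 2 * ((c - k + l : ℤ) : ℝ) := by
    rw [hk, hl]; push_cast; linarith
  rw [hz] at hij ⊢
  have : (0 : ℝ) < ((c - k + l : ℤ) : ℝ) := by linarith
  have h1 : (1 : ℤ) ≤ c - k + l := by exact_mod_cast this
  have h2 : (1 : ℝ) ≤ ((c - k + l : ℤ) : ℝ) := by exact_mod_cast h1
  linarith

theorem exists_weight_of_not_isEvenType (hπ : ¬ IsEvenType π) :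
    ∃ i j, weight π i = 1 ∧ weight π j = 0 := by
  obtain ⟨a, ha, b, hb, hae, hbo⟩ : ∃ a ∈ π.parts, ∃ b ∈ π.parts, Even a ∧ ¬ Even b := by
    by_contra! h
    exact hπ fun a ha b hb => ⟨h a ha b hb, h b hb a ha⟩
  have ha0 := π.parts_pos ha
  obtain ⟨k, rfl⟩ := hae
  obtain ⟨l, rfl⟩ := Nat.not_even_iff_odd.mp hbo
  obtain ⟨k, rfl⟩ : ∃ k', k = k' + 1 := ⟨k - 1, by lia⟩
  -- A block of even size has a weight 1, just before its middle; a block of odd size has a weight 0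
  -- at its middle.
  obtain ⟨i, hi⟩ := exists_index_of_weight π ha (k := k) (by lia)
  obtain ⟨j, hj⟩ := exists_index_of_weight π hb (k := l) (by lia)
  exact ⟨i, j, by rw [hi]; push_cast; ring, by rw [hj]; push_cast; ring⟩

/-- The bound for `K` on the orbit of a matrix of positive degree. -/
theorem HasDeg.four_div_le_K {h : Fin n → ℝ} {X C : Matrix (Fin n) (Fin n) ℂ} (hX : HasDeg h 2 X)
    (hC : C ∈ orbit X) (hD : 0 < discr C) (hS : 0 < normSq (diagonal fun i => (h i : ℂ))) :
    4 / normSq (diagonal fun i => (h i : ℂ)) ≤ K C := by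
  obtain ⟨P, Q, hPQ, rfl⟩ := mem_orbit_iff.mp hC
  obtain ⟨U, hU, T, S, -, hT, hS0, rfl, rfl⟩ := exists_unitary_mul_hasDeg_zero hPQ h
  rw [show U * T * X * (S * Uᴴ) = U * (T * X * S) * Uᴴ by simp only [Matrix.mul_assoc]] at hD ⊢
  rw [discr_unitary_conj hU] at hD
  rw [K_unitary_conj hU, K_eq, div_le_div_iff₀ hS hD]
  have hB : HasDeg h 2 (T * X * S) := by
    have := (hT.mul hX).mul hS0
    rwa [zero_add, add_zero] at this
  have h1 := hB.normSq_lie_ge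
  have h2 : discr (T * X * S) ≤ normSq (T * X * S) ^ 2 := sub_le_self _ (sq_nonneg _)
  linarith

theorem normSq_stdH_neg : normSq (diagonal fun i => ((-weight π i : ℝ) : ℂ)) = normSq (stdH π) := by
  rw [normSq_diagonal, stdH, normSq_diagonal]; simp

/-- B is conjugate to a multiple of E or E*, of degree 2 for the weights or for their negatives, so
K(B) = 4 / |H|² is the lower bound of `HasDeg.four_div_le_K`. -/
theorem attainsMin_of_isNilpotent {B : Matrix (Fin n) (Fin n) ℂ} (hB : B ∈ stdSl2 π) (hB0 : B ≠ 0)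
    (hnil : IsNilpotent B) : AttainsMin B := by
  have t := isUnitaryTriple_std π
  obtain ⟨a, b, c, rfl⟩ := (mem_stdSl2_iff π).mp hB
  have htr : ((comb (stdH π) (stdE π) a b c) ^ 2).trace = 0 :=
    (isNilpotent_trace_of_isNilpotent (hnil.pow_of_pos two_ne_zero)).eq_zero
  have hD : 0 < discr (comb (stdH π) (stdE π) a b c) := by
    have := normSq_pos.mpr hB0
    rw [discr, htr, norm_zero, zero_pow two_ne_zero, sub_zero]
    positivity
  have hS := t.normSq_pos_of_discr_pos hD
  refine (attainsMin_iff (t.trace_comb a b c)).mpr ⟨hD, fun C hC hCD => ?_⟩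
  rw [t.K_comb hD]
  have hE := hasDeg_stdE π
  rcases t.exists_mem_orbit (hE.isNilpotent two_pos) a b c with ⟨r, hr, ho⟩ | ⟨r, ho⟩ | ⟨r, ho⟩
  -- A nonzero multiple of H is not nilpotent, as the trace of its square is not zero.
  · exfalso
    have h1 := isNilpotent_of_mem_orbit ho hnil
    have h2 : ((r • stdH π) ^ 2).trace = 0 :=
      (isNilpotent_trace_of_isNilpotent (h1.pow_of_pos two_ne_zero)).eq_zero
    have h3 := t.trace_sq_comb r 0 0
    rw [show comb (stdH π) (stdE π) r 0 0 = r • stdH π by simp [comb], h2] at h3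
    have : (normSq (stdH π) : ℂ) ≠ 0 := by exact_mod_cast hS.ne'
    simp [this, hr] at h3
  · exact (hE.smul r).four_div_le_K (orbit_trans (orbit_symm ho) hC) hCD hS
  · rw [← normSq_stdH_neg] at hS ⊢
    exact (hE.conjTranspose.smul r).four_div_le_K (orbit_trans (orbit_symm ho) hC) hCD hS

/-- The bound for `K` on the orbit of a real diagonal matrix whose entries differ by at least
two. -/
theorem four_div_le_K_of_mem_orbit_diagonal {h : Fin n → ℝ} {C : Matrix (Fin n) (Fin n) ℂ}
    (hgap : ∀ i j, 0 < h i - h j → 2 ≤ h i - h j) (hC : C ∈ orbit (diagonal fun i => (h i : ℂ)))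
    (hD : 0 < discr C) (hS : 0 < normSq (diagonal fun i => (h i : ℂ))) :
    4 / normSq (diagonal fun i => (h i : ℂ)) ≤ K C := by
  set D : Matrix (Fin n) (Fin n) ℂ := diagonal fun i => (h i : ℂ) with hDdef
  obtain ⟨P, Q, hPQ, rfl⟩ := mem_orbit_iff.mp hC
  obtain ⟨U, hU, T, S, hTS, hT, hS0, rfl, rfl⟩ := exists_unitary_mul_hasDeg_zero hPQ h
  rw [show U * T * D * (S * Uᴴ) = U * (T * D * S) * Uᴴ by simp only [Matrix.mul_assoc]] at hD ⊢
  rw [discr_unitary_conj hU] at hD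
  rw [K_unitary_conj hU, K_eq, div_le_div_iff₀ hS hD]
  -- Entries of T between equal weights are killed by the bracket, and the other surviving ones
  -- cross a gap of at least 2.
  have hDT : HasDeg h 2 ⁅D, T⁆ := by
    intro i j hij
    rw [hDdef, lie_diagonal_apply]
    rcases lt_trichotomy (h i - h j) 0 with h1 | h1 | h1
    · rw [hT i j h1, mul_zero]
    · rw [h1]; simp
    · exact absurd (hgap i j h1) (not_le.mpr hij)
  have hN : HasDeg h 2 ((-1 : ℂ) • (⁅D, T⁆ * S)) := by
    have := (hDT.mul hS0).smul (-1)
    rwa [add_zero] at this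
  have hDN : T * D * S = D + (-1 : ℂ) • (⁅D, T⁆ * S) := by
    rw [Ring.lie_def, Matrix.sub_mul, Matrix.mul_assoc D, hTS]; simp
  rw [hDN]
  linarith [hN.normSq_lie_diagonal_add_ge]

theorem exists_smul_stdH_mem_orbit {a b c : ℂ}
    (hnil : ¬ IsNilpotent (comb (stdH π) (stdE π) a b c)) :
    ∃ r : ℂ, r ≠ 0 ∧ r • stdH π ∈ orbit (comb (stdH π) (stdE π) a b c) := by
  have hE := (hasDeg_stdE π).isNilpotent two_pos
  have hF := (hasDeg_stdE π).conjTranspose.isNilpotent two_pos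
  rcases (isUnitaryTriple_std π).exists_mem_orbit hE a b c with ⟨r, hr, ho⟩ | ⟨r, ho⟩ | ⟨r, ho⟩
  · exact ⟨r, hr, ho⟩
  · exact absurd (isNilpotent_of_mem_orbit (orbit_symm ho) (hE.smul r)) hnil
  · exact absurd (isNilpotent_of_mem_orbit (orbit_symm ho) (hF.smul r)) hnil

theorem attainsMin_of_isEvenType (hπ : IsEvenType π) {B : Matrix (Fin n) (Fin n) ℂ}
    (hB : B ∈ stdSl2 π) (hnil : ¬ IsNilpotent B) (hD : 0 < discr B) : AttainsMin B := by
  have t := isUnitaryTriple_std π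
  obtain ⟨a, b, c, rfl⟩ := (mem_stdSl2_iff π).mp hB
  have hS := t.normSq_pos_of_discr_pos hD
  refine (attainsMin_iff (t.trace_comb a b c)).mpr ⟨hD, fun C hC hCD => ?_⟩
  rw [t.K_comb hD]
  obtain ⟨r, hr, ho⟩ := exists_smul_stdH_mem_orbit hnil
  have h1 := orbit_smul r⁻¹ (orbit_trans (orbit_symm ho) hC)
  rw [smul_smul, inv_mul_cancel₀ hr, one_smul] at h1
  rw [← K_smul (inv_ne_zero hr)]
  refine four_div_le_K_of_mem_orbit_diagonal (fun i j => hπ.two_le_weight_sub) h1 ?_ hS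
  rw [discr_smul]
  have : 0 < ‖r⁻¹‖ := norm_pos_iff.mpr (inv_ne_zero hr)
  positivity

theorem single_mul_single_ne {i j : Fin n} (hij : i ≠ j) :
    (single i j 1 : Matrix (Fin n) (Fin n) ℂ) * single i j 1 = 0 :=
  single_mul_single_of_ne _ _ _ _ hij.symm _

/-- A transvection applied to a diagonal matrix with two entries that differ by one. -/
theorem diagonal_add_single_mem_orbit {h : Fin n → ℝ} {i j : Fin n} (hij : h i - h j = 1) :
    diagonal (fun i => (h i : ℂ)) + single i j 1 ∈ orbit (diagonal fun i => (h i : ℂ)) := by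
  have hne : i ≠ j := by rintro rfl; simp at hij
  set D : Matrix (Fin n) (Fin n) ℂ := diagonal fun i => (h i : ℂ) with hD
  set N : Matrix (Fin n) (Fin n) ℂ := single i j 1 with hN
  have hNN : N * N = 0 := single_mul_single_ne hne
  have hDN : D * N = (h i : ℂ) • N := by
    ext k l
    by_cases hk : i = k <;> simp [hD, hN, single_apply, hk]
  have hND : N * D = (h j : ℂ) • N := by
    ext k l
    by_cases hl : j = l <;> simp [hD, hN, single_apply, hl]
  refine mem_orbit_iff.mpr ⟨1 - N, 1 + N, ?_, ?_⟩
  · simp [Matrix.sub_mul, Matrix.mul_add, hNN]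
  · have hh : (h i : ℂ) = h j + 1 := by
      rw [← Complex.ofReal_one, ← Complex.ofReal_add]; congr 1; linarith
    simp only [Matrix.sub_mul, Matrix.mul_add, Matrix.one_mul, Matrix.mul_one, hDN, hND,
      Matrix.smul_mul, hNN, hh]
    module

theorem isUnitaryTriple_single {i j : Fin n} (hne : i ≠ j) :
    IsUnitaryTriple (n := n) (single i i 1 - single j j 1) (single i j 1) where
  isHermitian := by simp
  lie_h_e := by
    simp [Ring.lie_def, Matrix.sub_mul, Matrix.mul_sub, hne.symm, two_smul]
  lie_e_f := by simp [Ring.lie_def]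

/-- The competitor for types that are not even: a step of weight 1 instead of 2 brings K below 4 /
|D|². -/
theorem K_diagonal_add_single {h : Fin n → ℝ} {i j : Fin n} (hij : h i - h j = 1) :
    0 < discr (diagonal (fun i => (h i : ℂ)) + single i j 1) ∧
    K (diagonal (fun i => (h i : ℂ)) + single i j 1) =
      4 / (2 * normSq (diagonal fun i => (h i : ℂ)) + 1) := by
  have hne : i ≠ j := by rintro rfl; simp at hij
  have t := isUnitaryTriple_single hne
  set D : Matrix (Fin n) (Fin n) ℂ := diagonal fun i => (h i : ℂ) with hD
  have hDs : Dᴴ = D := by rw [hD, diagonal_conjTranspose]; congr 1; ext i; simp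
  set N : Matrix (Fin n) (Fin n) ℂ := single i j 1 with hN
  have hdeg : HasDeg h 1 N := fun k l hkl => by
    rw [hN, single_apply, if_neg]
    rintro ⟨rfl, rfl⟩
    linarith
  have hN1 : normSq N = 1 := by simp [normSq, hN]
  have hdiscr := hdeg.discr_diagonal_add one_pos
  rw [hN1, one_mul, ← hD] at hdiscr
  have hS := normSq_nonneg D
  refine ⟨by rw [hdiscr]; linarith, ?_⟩
  have hDN : ⁅D, N⁆ = N := by
    ext k l
    rw [hD, lie_diagonal_apply, hN, single_apply]
    split_ifs with hkl
    · rw [← hkl.1, ← hkl.2, hij]; simp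
    · simp
  have hDN' : ⁅D, Nᴴ⁆ = -Nᴴ := by
    have := congrArg conjTranspose hDN
    rw [conjTranspose_lie, hDs, ← lie_skew] at this
    exact neg_eq_iff_eq_neg.mp this
  have hμ : ⁅D + N, (D + N)ᴴ⁆ = comb (single i i 1 - single j j 1) N 1 (-1) (-1) := by
    rw [conjTranspose_add, hDs, add_lie, lie_add, lie_add, lie_self, hDN', ← lie_skew N D, hDN,
      t.lie_e_f, comb]
    module
  have hH : normSq (single i i 1 - single j j 1 : Matrix (Fin n) (Fin n) ℂ) = 2 := by
    have h1 := t.normSq_comb 0 1 0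
    rw [show comb (single i i 1 - single j j 1) N 0 1 0 = N by simp [comb], hN1] at h1
    simp at h1
    linarith
  rw [K_eq, hdiscr, hμ, t.normSq_comb, hH]
  norm_num

theorem not_attainsMin_of_not_isEvenType (hπ : ¬ IsEvenType π) {B : Matrix (Fin n) (Fin n) ℂ}
    (hB : B ∈ stdSl2 π) (hnil : ¬ IsNilpotent B) : ¬ AttainsMin B := by
  have t := isUnitaryTriple_std π
  obtain ⟨a, b, c, rfl⟩ := (mem_stdSl2_iff π).mp hB
  intro hmin
  obtain ⟨hD, hmin⟩ := (attainsMin_iff (t.trace_comb a b c)).mp hmin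
  have hS := t.normSq_pos_of_discr_pos hD
  obtain ⟨r, hr, ho⟩ := exists_smul_stdH_mem_orbit hnil
  obtain ⟨i, j, hi, hj⟩ := exists_weight_of_not_isEvenType hπ
  have hij : weight π i - weight π j = 1 := by rw [hi, hj, sub_zero]
  obtain ⟨hD', hK⟩ := K_diagonal_add_single hij
  have h1 := orbit_trans ho (orbit_smul r (diagonal_add_single_mem_orbit hij))
  have hr' : 0 < ‖r‖ := norm_pos_iff.mpr hr
  have h2 := hmin _ h1 (by rw [discr_smul]; positivity)
  rw [t.K_comb hD, K_smul hr, hK, div_le_div_iff₀ hS (by positivity)] at h2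
  rw [stdH] at h2 hS
  linarith

theorem K_eq_typeConst {B : Matrix (Fin n) (Fin n) ℂ} (hB : B ∈ stdSl2 π) (hZ : B ∉ Z n) :
    K B = typeConst π ∧
      typeConst π = 12 / (π.parts.map fun m : ℕ => (m : ℝ) * ((m : ℝ) ^ 2 - 1)).sum := by
  have t := isUnitaryTriple_std π
  obtain ⟨a, b, c, rfl⟩ := (mem_stdSl2_iff π).mp hB
  have hD := (notMem_Z_iff (t.trace_comb a b c)).mp hZ
  have hS := t.normSq_pos_of_discr_pos hD
  have hE : normSq (stdE π) = normSq (stdH π) / 2 := by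
    have h1 := t.normSq_comb 0 1 0
    rw [show comb (stdH π) (stdE π) 0 1 0 = stdE π by simp [comb]] at h1
    rw [h1]; simp; ring
  have hC : typeConst π = 4 / normSq (stdH π) := by
    rw [typeConst, K₀, t.lie_e_f, hE]
    field_simp; ring
  refine ⟨by rw [t.K_comb hD, hC], ?_⟩
  rw [hC, normSq_stdH] at *
  field_simp; ring

end Standard

end NessSl2

/-! ### Assembly of the four statements -/

open NessSl2

theorem mainTheorem2 (n : ℕ) (A : Matrix (Fin n) (Fin n) ℂ) (hA : A.trace = 0)
    (hscalar : ¬ ∃ c : ℂ, A = c • (1 : Matrix (Fin n) (Fin n) ℂ))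
    (hW : ¬ ∃ B ∈ NessSl2.W n \ NessSl2.Z n, B ∈ NessSl2.orbit A) :
    -- (1) critical points
    (NessSl2.IsCriticalPoint A ↔
      Module.finrank ℂ (NessSl2.genAlg A) = 3 ∧ NessSl2.IsSUConjToStd (NessSl2.genAlg A)) ∧
    -- (2) the value on the standard subalgebras
    (∀ π : n.Partition, ∀ B ∈ NessSl2.stdSl2 π, B ∉ NessSl2.Z n →
      NessSl2.K B = NessSl2.typeConst π ∧
      NessSl2.typeConst π = 12 / (π.parts.map fun m : ℕ => (m : ℝ) * ((m : ℝ) ^ 2 - 1)).sum) ∧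
    -- (3) minimum on nilpotent orbits
    (IsNilpotent A →
      (NessSl2.AttainsMin A ↔ ∃ π : n.Partition, NessSl2.SUConjInto A (NessSl2.stdSl2 π))) ∧
    -- (4) minimum on the other orbits
    (¬ IsNilpotent A →
      (NessSl2.AttainsMin A ↔
        A ∉ NessSl2.Z n ∧
          ∃ π : n.Partition, NessSl2.IsEvenType π ∧
            NessSl2.SUConjInto A (NessSl2.stdSl2 π))) := by
  have hA0 : A ≠ 0 := fun h0 => hscalar ⟨0, by rw [h0, zero_smul]⟩
  have hmin : AttainsMin A → ∃ π : n.Partition, SUConjInto A (stdSl2 π) := fun h =>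
    exists_conj_of_isSUConjToStd ((h.isCriticalPoint hA).isSUConjToStd hA hW).2
  have htrB : ∀ {B : Matrix (Fin n) (Fin n) ℂ} {π : n.Partition}, B ∈ stdSl2 π → B.trace = 0 := by
    intro B π hB
    obtain ⟨a, b, c, rfl⟩ := (mem_stdSl2_iff π).mp hB
    exact (isUnitaryTriple_std π).trace_comb a b c
  refine ⟨⟨fun h => h.isSUConjToStd hA hW, ?_⟩, fun π B => K_eq_typeConst, fun hnil => ⟨hmin, ?_⟩,
    fun hnil => ⟨fun h => ⟨h.1.2, ?_⟩, ?_⟩⟩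
  · rintro ⟨h3, hstd⟩
    have hD := discr_pos_of_finrank_genAlg hA0 h3
    refine (isCriticalPoint_iff hA).mpr ⟨hD, ?_⟩
    obtain ⟨π, U, hU, B, hB, rfl⟩ := exists_conj_of_isSUConjToStd hstd
    obtain ⟨a, b, c, rfl⟩ := (mem_stdSl2_iff π).mp hB
    rw [← IsUnitaryTriple.comb_unitary_conj] at hD ⊢
    exact ((isUnitaryTriple_std π).unitary_conj
      (mem_specialUnitaryGroup_iff.mp hU).1).critGrad_comb hD
  · rintro ⟨π, U, hU, B, hB, rfl⟩
    have hU' := (mem_specialUnitaryGroup_iff.mp hU).1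
    rw [attainsMin_unitary_conj hU' (htrB hB)]
    refine attainsMin_of_isNilpotent hB (fun h0 => hA0 (by rw [h0]; simp)) ?_
    exact isNilpotent_of_mem_orbit (orbit_symm (unitary_conj_mem_orbit hU' B)) hnil
  · obtain ⟨π, U, hU, B, hB, rfl⟩ := hmin h
    have hU' := (mem_specialUnitaryGroup_iff.mp hU).1
    refine ⟨π, ?_, U, hU, B, hB, rfl⟩
    by_contra hπ
    refine not_attainsMin_of_not_isEvenType hπ hB (fun hB' => hnil ?_)
      ((attainsMin_unitary_conj hU' (htrB hB)).mp h)
    exact isNilpotent_of_mem_orbit (unitary_conj_mem_orbit hU' B) hB'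
  · rintro ⟨hZ, π, hπ, U, hU, B, hB, rfl⟩
    have hU' := (mem_specialUnitaryGroup_iff.mp hU).1
    have hD := (notMem_Z_iff hA).mp hZ
    rw [discr_unitary_conj hU'] at hD
    rw [attainsMin_unitary_conj hU' (htrB hB)]
    refine attainsMin_of_isEvenType hπ hB (fun hB' => hnil ?_) hD
    exact isNilpotent_of_mem_orbit (unitary_conj_mem_orbit hU' B) hB'
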